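/- **Setting.** An $n$-punctured ball tangle diagram $T$ ($n\ge 0$) is a planar diagram, with finitely many transversal double points carrying over/under information, of a compact 1-manifold in a disc with $n$ numbered disjoint open discs (holes) removed; the boundary of the 1-manifold consists of exactly four marked points NW, SW, SE, NE, counterclockwise in this order, on each of the $n+1$ boundary circles. If $T$ is an $n$-punctured and $S_1,\dots,S_n$ are $k_1,\dots,k_n$-punctured ball tangle diagrams, then $T(S_1,\dots,S_n)$ is the $(k_1+\dots+k_n)$-punctured ball tangle diagram obtained by inserting $S_j$ into the $j$-th hole of $T$ for every $j$, matching NW with NW, etc.; its holes are those of $S_1$ in their order, then those of $S_2$, and so on. The Kauffman bracket of a link diagram $L$ at $A=e^{i\pi/4}$ is $\langle L\rangle=\sum_{\sigma}A^{\alpha(\sigma)-\beta(\sigma)}(-A^2-A^{-2})^{d(\sigma)-1}$, where $\sigma$ runs over all states (a choice of an $A$- or $B$-splitting at each crossing; the $A$-splitting joins the two regions swept out by rotating the over-strand counterclockwise), $\alpha(\sigma),\beta(\sigma)$ are the numbers of $A$- and $B$-splittings, $d(\sigma)$ is the number of circles of the split diagram, and $0^0=1$. The fundamental tangle $1$ consists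 of the arcs NW–SW and NE–SE, the fundamental tangle $2$ of the arcs NW–NE and SW–SE. The numerator closure joins NW with NE and SW with SE outside of the disc; the denominator closure joins NW with SW and NE with SE. For $f\in\{1,2\}^n$ let $T_{1f}$ and $T_{2f}$ be the numerator and the denominator closure, respectively, of $T$ with its $j$-th hole filled by the fundamental tangle $f_j$ for all $j$. Let $\alpha^n_1<\dots<\alpha^n_{2^n}$ be the elements of $\{1,2\}^n$ in dictionary order, $\alpha^n_i=(\alpha^n_{i1},\dots,\alpha^n_{in})$, and let $t_i$ be the number of coordinates of $\alpha_i^n$ equal to $2$. Let $PM_{m\times l}(\mathbb Z)$ be the set of classes $[M]=\{M,-M\}$ of $m\times l$ integer matrices, with $[M][N]=[MN]$. Put $$F^n(T)=\left\{z\begin{pmatrix}(-i)^{t_1}\langle T_{1\alpha^n_1}\rangle&\cdots&(-i)^{t_{2^n}}\langle T_{1\alpha^n_{2^n}}\rangle\\ (-i)^{t_1}i\langle T_{2\alpha^n_1}\rangle&\cdots&(-i)^{t_{2^n}}i\langle T_{2\alpha^n_{2^n}}\rangle\end{pmatrix}\;:\;z\in\mathbb C,\ z^8=1\right\}\cap M_{2\times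 2^n}(\mathbb Z).$$ **Theorem 3.8.** Let $n\ge 1$ and $k_1,\dots,k_n\ge 0$ be integers, put $K=k_1+\dots+k_n$, and let $T^n,T^{k_1(1)},\dots,T^{k_n(n)}$ be $n,k_1,\dots,k_n$-punctured ball tangle diagrams, respectively. Then $F^n(T^n)$, $F^{k_j}(T^{k_j(j)})$ ($1\le j\le n$) and $F^{K}(T^n(T^{k_1(1)},\dots,T^{k_n(n)}))$ are elements of $PM_{2\times 2^n}(\mathbb Z)$, $PM_{2\times 2^{k_j}}(\mathbb Z)$ and $PM_{2\times 2^{K}}(\mathbb Z)$, respectively, and if $F^{k_j}(T^{k_j(j)})=[(b^j_{rc})]$ with $b^j\in M_{2\times 2^{k_j}}(\mathbb Z)$ for $1\le j\le n$, then $$F^{K}\bigl(T^n(T^{k_1(1)},\dots,T^{k_n(n)})\bigr)=F^n(T^n)\,[\eta],$$ where $\eta$ is the $2^n\times 2^{K}$ integer matrix with entries $$\eta_{rc}=\prod_{j=1}^n b^j_{\alpha^n_{rj}\,\gamma_{cj}}\qquad(1\le r\le 2^n,\ 1\le c\le 2^{K}),$$ and $\gamma_1<\dots<\gamma_{2^{K}}$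 are the elements $\gamma_c=(\gamma_{c1},\dots,\gamma_{cn})$ of $\prod_{j=1}^n\{1,\dots,2^{k_j}\}$ in dictionary order. -/

import Mathlib

/-! ### Planar pairings of four points

The four ends at a crossing, and the four marked points on a boundary circle of a punctured ball
tangle diagram, are numbered `0, 1, 2, 3` counterclockwise in the projection plane. For marked
points, `0 = NW`, `1 = SW`, `2 = SE`, `3 = NE`. -/

/-- The pairing `0 – 1`, `2 – 3` of four cyclically ordered points
(for marked points: `NW – SW` and `SE – NE`). -/
def pairV (i : Fin 4) : Fin 4 := 1 - i

/-- The pairing `0 – 3`, `1 – 2` of four cyclically ordered points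
(for marked points: `NW – NE` and `SW – SE`). -/
def pairH (i : Fin 4) : Fin 4 := 3 - i

/-! ### Link diagrams and the Kauffman bracket -/

/-- A link diagram, recorded combinatorially. Each crossing `c` has four ends
`(c, 0), (c, 1), (c, 2), (c, 3)`, listed counterclockwise, where the over-strand consists of the
ends `0` and `2` and the under-strand of the ends `1` and `3`. There may also be finitely many
auxiliary bivalent points on the strands; the two sides of such a point are two elements of `Mark`,
exchanged by `through`. The arcs between crossings and auxiliary points are recorded by `edge`,
which sends every end to the other end of the arc that starts there. A circle without
crossings is a circle through auxiliary points only. -/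
structure LinkDiagram where
  Crossing : Type
  Mark : Type
  [fintypeCrossing : Fintype Crossing]
  [decEqCrossing : DecidableEq Crossing]
  [finiteMark : Finite Mark]
  through : Mark → Mark
  through_involutive : Function.Involutive through
  through_ne : ∀ x, through x ≠ x
  edge : (Crossing × Fin 4) ⊕ Mark → (Crossing × Fin 4) ⊕ Mark
  edge_involutive : Function.Involutive edge
  edge_ne : ∀ x, edge x ≠ x

attribute [instance] LinkDiagram.fintypeCrossing LinkDiagram.decEqCrossing LinkDiagram.finiteMark

/-- The two ways of splitting a crossing. -/
inductive Splitting
  | A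
  | B
  deriving DecidableEq

instance : Fintype Splitting := ⟨{.A, .B}, by rintro (_ | _) <;> simp⟩

/-- How a splitting reconnects the four ends of a crossing. Rotating the over-strand `0 – 2`
counterclockwise sweeps out the regions between the ends `0, 1` and between the ends `2, 3`: these
are the `A`-regions. The `A`-splitting joins them, so it connects `0` with `3` and `1` with `2`. The
`B`-splitting connects `0` with `1` and `2` with `3`. -/
def Splitting.reconnect : Splitting → Fin 4 → Fin 4
  | .A => pairH
  | .B => pairV

namespace LinkDiagram

/-- A state chooses a splitting at every crossing. -/
abbrev State (L : LinkDiagram) : Type := L.Crossing → Splitting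

/-- How the ends are connected at the (split) crossings and at the auxiliary points. -/
def smooth (L : LinkDiagram) (s : L.State) :
    (L.Crossing × Fin 4) ⊕ L.Mark → (L.Crossing × Fin 4) ⊕ L.Mark
  | .inl (c, i) => .inl (c, (s c).reconnect i)
  | .inr x => .inr (L.through x)

/-- The number `d(s)` of circles of the diagram obtained by splitting all crossings as `s` says. -/
noncomputable def circles (L : LinkDiagram) (s : L.State) : ℕ :=
  Nat.card (Quot fun x y => y = L.edge x ∨ y = L.smooth s x)

/-- The Kauffman bracket
`⟨L⟩_a = ∑_s a ^ α(s) * (a⁻¹) ^ β(s) * (- a ^ 2 - a ^ (-2)) ^ (d(s) - 1)`, where `α(s)` and `β(s)`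
are the numbers of `A`- and of `B`-splittings of the state `s`. -/
noncomputable def kauffman (L : LinkDiagram) (a : ℂ) : ℂ :=
  ∑ s : L.State, a ^ (Finset.univ.filter fun c => s c = .A).card *
    a⁻¹ ^ (Finset.univ.filter fun c => s c = .B).card *
    (-a ^ 2 - a⁻¹ ^ 2) ^ (L.circles s - 1)

/-- The Kauffman bracket at `e ^ (i π / 4)`. -/
noncomputable def bracket (L : LinkDiagram) : ℂ :=
  L.kauffman (Complex.exp (Complex.I * Real.pi / 4))

end LinkDiagram

/-! ### Diagrams of `n`-punctured ball tangles -/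

/-- The combinatorial data of a diagram of an `n`-punctured ball tangle with four marked points on
each of the `n + 1` boundary circles. The ends are: the four ends of each crossing (conventions as
for link diagrams), the two sides of each auxiliary bivalent point on a strand, the four marked
points on the circle around each hole, and the four marked points on the outer circle. The strands
between them are recorded by `edge`, which sends every end to the other end of the arc that starts
there. That the data come from a diagram in the plane is expressed by `TangleDiagram.IsPlanar`. -/
structure TangleDiagram (n : ℕ) where
  Crossing : Type
  Mark : Type
  [fintypeCrossing : Fintype Crossing]
  [decEqCrossing : DecidableEq Crossing]
  [finiteMark : Finite Mark]
  through : Mark → Mark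
  through_involutive : Function.Involutive through
  through_ne : ∀ x, through x ≠ x
  edge : (Crossing × Fin 4) ⊕ (Mark ⊕ ((Fin n × Fin 4) ⊕ Fin 4)) →
    (Crossing × Fin 4) ⊕ (Mark ⊕ ((Fin n × Fin 4) ⊕ Fin 4))
  edge_involutive : Function.Involutive edge
  edge_ne : ∀ x, edge x ≠ x

attribute [instance] TangleDiagram.fintypeCrossing TangleDiagram.decEqCrossing
  TangleDiagram.finiteMark

namespace TangleDiagram

/-- The ends of a diagram: crossing ends, sides of auxiliary points, marked points on the circles
around the holes, marked points on the outer circle. -/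
abbrev End {n : ℕ} (T : TangleDiagram n) : Type :=
  (T.Crossing × Fin 4) ⊕ (T.Mark ⊕ ((Fin n × Fin 4) ⊕ Fin 4))

/-- The next end counterclockwise around the same vertex, when the diagram is drawn on the sphere
with every hole and the outside of the outer circle shrunk to a vertex. Around the vertex that
replaces the outside, the orientation is opposite to that of the outer circle. -/
def rotation {n : ℕ} (T : TangleDiagram n) : T.End → T.End
  | .inl (c, i) => .inl (c, i + 1)
  | .inr (.inl x) => .inr (.inl (T.through x))
  | .inr (.inr (.inl (j, i))) => .inr (.inr (.inl (j, i + 1)))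
  | .inr (.inr (.inr i)) => .inr (.inr (.inr (i - 1)))

/-- The diagram is planar: every component of the graph drawn on an oriented surface by `rotation`
and `edge` has genus zero, that is, `V - E + F = 2 C`, where the vertices, edges and faces are the
orbits of `rotation`, of `edge` and of `rotation ∘ edge`, and the components are the orbits of
`rotation` and `edge` together (each component satisfies `V - E + F ≤ 2`). -/
def IsPlanar {n : ℕ} (T : TangleDiagram n) : Prop :=
  Nat.card (Quot fun x y : T.End => y = T.rotation x) +
      Nat.card (Quot fun x y : T.End => y = T.rotation (T.edge x)) =
    Nat.card (Quot fun x y : T.End => y = T.edge x) +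
      2 * Nat.card (Quot fun x y : T.End => y = T.rotation x ∨ y = T.edge x)

/-- The two fundamental ball tangles `1` and `2` (indices `0` and `1` of `Fin 2`), as pairings
of the marked points: the first one consists of the arcs `NW – SW` and `NE – SE`, the
second one of the arcs `NW – NE` and `SW – SE`. -/
def fundamental : Fin 2 → Fin 4 → Fin 4 := ![pairV, pairH]

/-- The two closures (indices `0` and `1` of `Fin 2`), as pairings of the marked points on the outer
circle by arcs outside of it: the numerator closure joins `NW – NE` and `SW – SE`, the denominator
closure joins `NW – SW` and `NE – SE`. -/
def closingArcs : Fin 2 → Fin 4 → Fin 4 := ![pairH, pairV]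

/-- How ends are connected through auxiliary points, through holes filled with fundamental tangles
`f`, and outside of the outer circle by the closure `r`. -/
def fillThrough {n : ℕ} (T : TangleDiagram n) (r : Fin 2) (f : Fin n → Fin 2) :
    T.Mark ⊕ ((Fin n × Fin 4) ⊕ Fin 4) → T.Mark ⊕ ((Fin n × Fin 4) ⊕ Fin 4)
  | .inl x => .inl (T.through x)
  | .inr (.inl (j, i)) => .inr (.inl (j, fundamental (f j) i))
  | .inr (.inr i) => .inr (.inr (closingArcs r i))

theorem fundamental_invol : ∀ s i, fundamental s (fundamental s i) = i := by decide

theorem fundamental_ne : ∀ s i, fundamental s i ≠ i := by decide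

theorem closingArcs_invol : ∀ s i, closingArcs s (closingArcs s i) = i := by decide

theorem closingArcs_ne : ∀ s i, closingArcs s i ≠ i := by decide

/-- The link diagram `T_{r f}`: fill the `j`-th hole of `T` with the fundamental tangle `f j`
for every `j`, then take the closure `r` (numerator or denominator) of the result. -/
def closeUp {n : ℕ} (T : TangleDiagram n) (r : Fin 2) (f : Fin n → Fin 2) : LinkDiagram where
  Crossing := T.Crossing
  Mark := T.Mark ⊕ ((Fin n × Fin 4) ⊕ Fin 4)
  through := T.fillThrough r f
  through_involutive := by
    rintro (x | ⟨j, i⟩ | i)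
    · simp [fillThrough, T.through_involutive x]
    · simp [fillThrough, fundamental_invol]
    · simp [fillThrough, closingArcs_invol]
  through_ne := by
    rintro (x | ⟨j, i⟩ | i)
    · simp [fillThrough, T.through_ne x]
    · simp [fillThrough, fundamental_ne]
    · simp [fillThrough, closingArcs_ne]
  edge := T.edge
  edge_involutive := T.edge_involutive
  edge_ne := T.edge_ne

section Composition

variable {n : ℕ} {k : Fin n → ℕ} (T : TangleDiagram n) (S : ∀ j, TangleDiagram (k j))

/-- The auxiliary points of the composite: those of `T`, those of the inserted diagrams, and,
for every hole `j` of `T` and `i : Fin 4`, a new point `(j, i)` with the two sides `((j, i), 0)` and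
`((j, i), 1)`, where the `i`-th marked point of the hole is glued to the `i`-th marked point of the
outer circle of `S j`. -/
abbrev CompMark : Type := T.Mark ⊕ ((Σ j, (S j).Mark) ⊕ ((Fin n × Fin 4) × Fin 2))

/-- The ends of the composite. Its holes are those of `S 0`, followed by those of `S 1`, etc. -/
abbrev CompEnd : Type :=
  ((T.Crossing ⊕ (Σ j, (S j).Crossing)) × Fin 4) ⊕
    (CompMark T S ⊕ ((Fin (∑ j, k j) × Fin 4) ⊕ Fin 4))

/-- The two sides of an auxiliary point of the composite. -/
def compThrough : CompMark T S → CompMark T S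
  | .inl x => .inl (T.through x)
  | .inr (.inl ⟨j, x⟩) => .inr (.inl ⟨j, (S j).through x⟩)
  | .inr (.inr (p, b)) => .inr (.inr (p, 1 - b))

/-- The end of one of the pieces that corresponds to an end of the composite. -/
def toPiece : CompEnd T S → T.End ⊕ (Σ j, (S j).End)
  | .inl (.inl c, i) => .inl (.inl (c, i))
  | .inl (.inr ⟨j, c⟩, i) => .inr ⟨j, .inl (c, i)⟩
  | .inr (.inl (.inl x)) => .inl (.inr (.inl x))
  | .inr (.inl (.inr (.inl ⟨j, x⟩))) => .inr ⟨j, .inr (.inl x)⟩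
  | .inr (.inl (.inr (.inr ((j, i), 0)))) => .inl (.inr (.inr (.inl (j, i))))
  | .inr (.inl (.inr (.inr ((j, i), 1)))) => .inr ⟨j, .inr (.inr (.inr i))⟩
  | .inr (.inr (.inl (h, i))) =>
      .inr ⟨(finSigmaFinEquiv.symm h).1, .inr (.inr (.inl ((finSigmaFinEquiv.symm h).2, i)))⟩
  | .inr (.inr (.inr i)) => .inl (.inr (.inr (.inr i)))

/-- The end of the composite that corresponds to an end of one of the pieces. -/
def ofPiece : T.End ⊕ (Σ j, (S j).End) → CompEnd T S
  | .inl (.inl (c, i)) => .inl (.inl c, i)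
  | .inl (.inr (.inl x)) => .inr (.inl (.inl x))
  | .inl (.inr (.inr (.inl (j, i)))) => .inr (.inl (.inr (.inr ((j, i), 0))))
  | .inl (.inr (.inr (.inr i))) => .inr (.inr (.inr i))
  | .inr ⟨j, .inl (c, i)⟩ => .inl (.inr ⟨j, c⟩, i)
  | .inr ⟨j, .inr (.inl x)⟩ => .inr (.inl (.inr (.inl ⟨j, x⟩)))
  | .inr ⟨j, .inr (.inr (.inl (m, i)))⟩ => .inr (.inr (.inl (finSigmaFinEquiv ⟨j, m⟩, i)))
  | .inr ⟨j, .inr (.inr (.inr i))⟩ => .inr (.inl (.inr (.inr ((j, i), 1))))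

/-- The arcs of the composite are the arcs of `T` and of the inserted diagrams. -/
def pieceEdge : T.End ⊕ (Σ j, (S j).End) → T.End ⊕ (Σ j, (S j).End)
  | .inl x => .inl (T.edge x)
  | .inr ⟨j, x⟩ => .inr ⟨j, (S j).edge x⟩

theorem ofPiece_toPiece (x : CompEnd T S) : ofPiece T S (toPiece T S x) = x := by
  rcases x with ⟨c | ⟨j, c⟩, i⟩ | (x | ⟨j, x⟩ | ⟨⟨j, i⟩, b⟩) | ⟨h, i⟩ | i
  any_goals rfl
  · fin_cases b <;> rfl
  · simp [toPiece, ofPiece]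

theorem toPiece_ofPiece (x : T.End ⊕ (Σ j, (S j).End)) :
    toPiece T S (ofPiece T S x) = x := by
  rcases x with (⟨c, i⟩ | x | ⟨j, i⟩ | i) | ⟨j, ⟨c, i⟩ | x | ⟨m, i⟩ | i⟩
  any_goals rfl
  simp only [toPiece, ofPiece]
  rw [Equiv.symm_apply_apply]

theorem pieceEdge_involutive : Function.Involutive (pieceEdge T S) := by
  rintro (x | ⟨j, x⟩)
  · simp [pieceEdge, T.edge_involutive x]
  · simp [pieceEdge, (S j).edge_involutive x]

theorem pieceEdge_ne (x : T.End ⊕ (Σ j, (S j).End)) : pieceEdge T S x ≠ x := by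
  rcases x with x | ⟨j, x⟩
  · simp [pieceEdge, T.edge_ne x]
  · simp [pieceEdge, (S j).edge_ne x]

/-- The operadic composite `T (S 0, …, S (n - 1))`: the `j`-th hole of `T` is filled with the
punctured ball tangle diagram `S j`, marked points of the hole being glued to the marked points with
the same number on the outer circle of `S j`. -/
def comp : TangleDiagram (∑ j, k j) where
  Crossing := T.Crossing ⊕ (Σ j, (S j).Crossing)
  Mark := CompMark T S
  through := compThrough T S
  through_involutive := by
    rintro (x | ⟨j, x⟩ | ⟨p, b⟩)
    · simp [compThrough, T.through_involutive x]
    · simp [compThrough, (S j).through_involutive x]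
    · simp [compThrough]
  through_ne := by
    rintro (x | ⟨j, x⟩ | ⟨p, b⟩)
    · simp [compThrough, T.through_ne x]
    · simp [compThrough, (S j).through_ne x]
    · fin_cases b <;> simp [compThrough]
  edge x := ofPiece T S (pieceEdge T S (toPiece T S x))
  edge_involutive x := by
    simp only [toPiece_ofPiece, pieceEdge_involutive T S (toPiece T S x), ofPiece_toPiece]
  edge_ne x h := by
    have h' := congrArg (toPiece T S) h
    rw [toPiece_ofPiece] at h'
    exact pieceEdge_ne T S _ h'

end Composition

end TangleDiagram

/-! ### Dictionary orders -/

/-- The dictionary enumeration `α_1 < α_2 < … < α_m` of `∏ j, {1, …, d j}` (with all indices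
shifted to start at `0`): the increasing bijection from `{1, …, m}` onto the product with the
lexicographic order, where `m` is the number of elements of the product. -/
noncomputable def dict {n : ℕ} (d : Fin n → ℕ) {m : ℕ} (h : ∏ j, d j = m) :
    Fin m ≃o Lex (∀ j, Fin (d j)) :=
  Fintype.orderIsoFinOfCardEq _ (by rw [Fintype.card_lex, Fintype.card_pi]; simpa using h)

/-- The `i`-th element `α_i^n` of `{1, 2}^n` in the dictionary order. -/
noncomputable def alpha (n : ℕ) (i : Fin (2 ^ n)) : Fin n → Fin 2 :=
  ofLex (dict (fun _ : Fin n => 2) (by simp) i)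

/-- The `i`-th element of `∏ j, {1, …, 2 ^ k j}` in the dictionary order. -/
noncomputable def alphaPow {n : ℕ} (k : Fin n → ℕ) (i : Fin (2 ^ ∑ j, k j)) :
    ∀ j, Fin (2 ^ k j) :=
  ofLex (dict (fun j => 2 ^ k j) (Finset.prod_pow_eq_pow_sum _ _ _) i)

/-- The exponents `t_1, …, t_{2 ^ n}` (with indices starting at `0`), defined recursively: `(0)` for
`n = 0`, and `(t_1, …, t_{2 ^ n}, t_1 + 1, …, t_{2 ^ n} + 1)` for `n + 1`. -/
def tExponent : ℕ → ℕ → ℕ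
  | 0, _ => 0
  | n + 1, i => if i < 2 ^ n then tExponent n i else tExponent n (i - 2 ^ n) + 1

/-! ### Integer matrices modulo sign and the invariant -/

/-- The class `[M] = {M, -M}` of an integer matrix modulo multiplication by `±1`. -/
def signClass {m n : ℕ} (M : Matrix (Fin m) (Fin n) ℤ) : Set (Matrix (Fin m) (Fin n) ℤ) :=
  {M, -M}

/-- The set `PM_{m × n}(ℤ)` of all `m × n` integer matrices modulo multiplication by `±1`. -/
def PM (m n : ℕ) : Set (Set (Matrix (Fin m) (Fin n) ℤ)) :=
  Set.range signClass

/-- The product of classes of matrices modulo `±1`, so that `[M] [N] = [M N]`. -/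
def classMul {l m n : ℕ} (P : Set (Matrix (Fin l) (Fin m) ℤ)) (Q : Set (Matrix (Fin m) (Fin n) ℤ)) :
    Set (Matrix (Fin l) (Fin n) ℤ) :=
  Set.image2 (fun M N => M * N) P Q

/-- The complex `2 × 2 ^ n` matrix with the entries `(-i) ^ t_c * ⟨T_{1 α_c}⟩` in the first row and
`(-i) ^ t_c * i * ⟨T_{2 α_c}⟩` in the second row. -/
noncomputable def bracketMatrix {n : ℕ} (T : TangleDiagram n) :
    Matrix (Fin 2) (Fin (2 ^ n)) ℂ :=
  Matrix.of fun r c =>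
    (-Complex.I) ^ tExponent n c * Complex.I ^ (r : ℕ) * (T.closeUp r (alpha n c)).bracket

/-- The invariant `F^n(T) = {z X | z ^ 8 = 1} ∩ M_{2 × 2 ^ n}(ℤ)`, where `X` is the
bracket matrix of `T`. -/
def tangleInvariant {n : ℕ} (T : TangleDiagram n) : Set (Matrix (Fin 2) (Fin (2 ^ n)) ℤ) :=
  {M | ∃ z : ℂ, z ^ 8 = 1 ∧ M.map (fun a : ℤ => (a : ℂ)) = z • bracketMatrix T}

/-- The `2 ^ n × 2 ^ (k_1 + … + k_n)` matrix whose entry in row `r` and column `c` is the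
product over `j` of the entries of `b j` in row `(α_r^n)_j` and in column
`(α_c^{n, 2 ^ k_1, …, 2 ^ k_n})_j`. -/
noncomputable def eta {n : ℕ} (k : Fin n → ℕ) (b : ∀ j, Matrix (Fin 2) (Fin (2 ^ k j)) ℤ) :
    Matrix (Fin (2 ^ n)) (Fin (2 ^ ∑ j, k j)) ℤ :=
  Matrix.of fun r c => ∏ j, b j (alpha n r j) (alphaPow k c j)

/-! At `rootEight` the value of a free circle is `0`, so a bracket is a weighted count of the states
with exactly one circle (`LinkDiagram.bracket_eq_sum`). A state of a diagram with `C` crossings and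
`α` `A`-splittings has weight `rootEight⁻¹ ^ C * I ^ α`, so integrality is a question about the
parity of `α`.

That parity comes from planarity. In genus zero the first mod 2 cohomology vanishes, so the ends can
be two-colored with both `edge` and `rotation` changing the color (`exists_coloring_of_euler`,
`IsPlanar.exists_coloring`). Circles are then cycles of a permutation of one color class, and
switching the pairing at one vertex multiplies it by a transposition. Hence `(-1) ^ circles` changes
sign with every switched crossing, hole or closure (`IsPlanar.exists_neg_one_pow_circles`). All
one-circle states of all closures therefore share one parity, and a single eighth root of unity
makes the whole bracket matrix integral (`IsPlanar.exists_integral`). It is unique up to sign, since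
the ratio of two integral multiples of a nonzero matrix is rational
(`tangleInvariant_eq_signClass`).

For composites, the coloring and the parity show that each split inserted diagram connects its outer
ends like a fundamental tangle (`IsPlanar.exists_hasType`). A state of the composite is one circle
exactly when `T`, filled with these fundamental tangles, is one circle and each inserted diagram,
closed the complementary way, is one circle (`circles_comp_eq_one_iff`). Other closures of that
state of an inserted diagram give at least two circles and contribute nothing, so the bracket of the
composite expands as a sum over fillings (`bracket_comp`). The powers of `-i` and `i` in the bracket
matrix cancel in this sum, which makes it a matrix product. -/

/-! ### Parity of the number of cycles of a permutation -/

open Equiv Equiv.Perm in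
/-- The sign of a permutation in terms of its number of orbits. -/
theorem sign_eq_neg_one_pow_orbits {α : Type*} [Fintype α] [DecidableEq α] (σ : Perm α) :
    sign σ = (-1) ^ (Fintype.card α + Nat.card (Quotient (SameCycle.setoid σ))) := by
  classical
  -- The cycle type omits fixed points, so an orbit is encoded either as a nontrivial cycle or as a
  -- fixed point.
  let F : α → Perm α ⊕ α := fun x => if σ x = x then .inr x else .inl (σ.cycleOf x)
  have hF : ∀ x y, F x = F y ↔ σ.SameCycle x y := by
    intro x y
    by_cases hx : σ x = x <;> by_cases hy : σ y = y
    · simp only [F, hx, hy, if_true, Sum.inr.injEq]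
      exact ⟨fun h => h ▸ SameCycle.refl _ _, fun h => (h.eq_of_left hx)⟩
    · simp only [F, hx, hy, if_true, if_false, reduceCtorEq, false_iff]
      intro h
      exact hy (h.apply_eq_self_iff.1 hx)
    · simp only [F, hx, hy, if_true, if_false, reduceCtorEq, false_iff]
      intro h
      exact hx (h.apply_eq_self_iff.2 hy)
    · simp only [F, hx, hy, if_false, Sum.inl.injEq]
      constructor
      · intro h
        have : (σ.cycleOf x) x ≠ x := by rwa [cycleOf_apply_self]
        rw [h] at this
        by_contra hn
        exact this (cycleOf_apply_of_not_sameCycle fun h' => hn h'.symm)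
      · exact fun h => h.cycleOf_eq
  have e1 : Nat.card (Quotient (SameCycle.setoid σ)) = Nat.card (Set.range F) := by
    refine Nat.card_congr (Equiv.ofBijective
      (Quotient.lift (fun x => (⟨F x, x, rfl⟩ : Set.range F)) ?_) ⟨?_, ?_⟩)
    · intro x y h
      exact Subtype.ext ((hF x y).2 h)
    · rintro ⟨x⟩ ⟨y⟩ h
      exact Quotient.sound ((hF x y).1 (congrArg Subtype.val h))
    · rintro ⟨_, x, rfl⟩
      exact ⟨⟦x⟧, rfl⟩
  have e2 : Set.range F = (σ.cycleFactorsFinset.disjSum (σ.supportᶜ) : Finset _) := by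
    ext (c | x)
    · simp only [Set.mem_range, SetLike.mem_coe, Finset.inl_mem_disjSum]
      constructor
      · rintro ⟨x, hx⟩
        by_cases h : σ x = x
        · simp [F, h] at hx
        · simp only [F, h, if_false, Sum.inl.injEq] at hx
          rw [← hx]
          exact cycleOf_mem_cycleFactorsFinset_iff.2 (mem_support.2 h)
      · intro hc
        obtain ⟨hcyc, hc2⟩ := mem_cycleFactorsFinset_iff.1 hc
        obtain ⟨x, hx, -⟩ := id hcyc
        have hxs : x ∈ c.support := mem_support.2 hx
        refine ⟨x, ?_⟩
        have h : σ x ≠ x := by rw [← hc2 x hxs]; exact hx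
        simp only [F, h, if_false, Sum.inl.injEq]
        exact (cycle_is_cycleOf hxs hc).symm
    · simp only [Set.mem_range, SetLike.mem_coe, Finset.inr_mem_disjSum, Finset.mem_compl,
        mem_support, not_not]
      constructor
      · rintro ⟨y, hy⟩
        by_cases h : σ y = y
        · simp only [F, h, if_true, Sum.inr.injEq] at hy
          exact hy ▸ h
        · simp [F, h] at hy
      · intro hx
        exact ⟨x, by simp [F, hx]⟩
  rw [e1, e2, Nat.card_coe_set_eq, Set.ncard_coe_finset, Finset.card_disjSum, Finset.card_compl,
    sign_of_cycleType, sum_cycleType, cycleType_def, Multiset.card_map]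
  have hle : σ.support.card ≤ Fintype.card α := Finset.card_le_univ _
  have : Fintype.card α + (σ.cycleFactorsFinset.card + (Fintype.card α - σ.support.card)) =
      σ.support.card + σ.cycleFactorsFinset.card + 2 * (Fintype.card α - σ.support.card) := by
    omega
  rw [this, pow_add _ _ (2 * _), pow_mul]
  simp

/-! ### Parity of the number of circles of two color-exchanging involutions -/

/-- The number of orbits of the group generated by two maps. -/
noncomputable def orbitNumber {X : Type*} (e m : X → X) : ℕ :=
  Nat.card (Quot fun x y => y = e x ∨ y = m x)

section Bicolored

variable {X : Type*} {e m m' : X → X} {ε : X → Bool}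

/-- The composite of two involutions that exchange the colors, on the first color class. -/
def colorPerm (he : Function.Involutive e) (hm : Function.Involutive m)
    (hεe : ∀ x, ε (e x) = !ε x) (hεm : ∀ x, ε (m x) = !ε x) :
    Equiv.Perm {x // ε x = true} where
  toFun x := ⟨m (e x), by rw [hεm, hεe, x.2]; rfl⟩
  invFun x := ⟨e (m x), by rw [hεe, hεm, x.2]; rfl⟩
  left_inv x := by simp [hm (e x), he x.1]
  right_inv x := by simp [he (m x), hm x.1]

/-- Words of even length in the two involutions preserve the color and are powers of `m ∘ e` or its
inverse, so each orbit meets the first color class in exactly one cycle. -/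
theorem orbitNumber_eq [Finite X] (he : Function.Involutive e) (hm : Function.Involutive m)
    (hεe : ∀ x, ε (e x) = !ε x) (hεm : ∀ x, ε (m x) = !ε x) :
    orbitNumber e m =
      Nat.card (Quotient (Equiv.Perm.SameCycle.setoid (colorPerm he hm hεe hεm))) := by
  set π := colorPerm he hm hεe hεm
  have step : ∀ p : {x // ε x = true}, (Quot.mk (fun x y => y = e x ∨ y = m x) p.1) =
      Quot.mk _ (π p).1 := fun p =>
    (Quot.sound (r := fun x y => y = e x ∨ y = m x) (Or.inl rfl)).trans
      (Quot.sound (r := fun x y => y = e x ∨ y = m x) (Or.inr rfl))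
  -- A point of the second color is represented by its `e`-neighbor, which has the first color.
  let toF : X → Quotient (Equiv.Perm.SameCycle.setoid π) := fun x =>
    if h : ε x = true then ⟦⟨x, h⟩⟧ else ⟦⟨e x, by rw [hεe]; simpa using h⟩⟧
  have hπ : ∀ p, (⟦π p⟧ : Quotient (Equiv.Perm.SameCycle.setoid π)) = ⟦p⟧ := fun p =>
    Quotient.sound (Equiv.Perm.sameCycle_apply_left.2 (Equiv.Perm.SameCycle.refl _ _))
  have hF : ∀ x y, (y = e x ∨ y = m x) → toF x = toF y := by
    rintro x y (rfl | rfl)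
    · by_cases h : ε x = true
      · have h' : ¬ ε (e x) = true := by rw [hεe, h]; decide
        simp only [toF, h, h', dif_pos, he x]
        rfl
      · have h' : ε (e x) = true := by rw [hεe]; simpa using h
        simp only [toF, h, h']
        rfl
    · by_cases h : ε x = true
      · have h' : ¬ ε (m x) = true := by rw [hεm, h]; decide
        have h2 : ε (e (m x)) = true := by rw [hεe, hεm, h]; rfl
        have := hπ ⟨e (m x), h2⟩
        simp only [toF, h, h', dif_pos]
        refine Eq.trans ?_ this
        congr 1
        apply Subtype.ext
        simp [π, colorPerm, he (m x), hm x]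
      · have h' : ε (m x) = true := by rw [hεm]; simpa using h
        have h2 : ε (e x) = true := by rw [hεe]; simpa using h
        have := hπ ⟨e x, h2⟩
        simp only [toF, h, h']
        refine this.symm.trans ?_
        simp [π, colorPerm, he x]
  refine Nat.card_congr ⟨Quot.lift toF hF, Quotient.lift (fun p => Quot.mk _ p.1) ?_, ?_, ?_⟩
  · intro p q hpq
    obtain ⟨i, hi⟩ := Equiv.Perm.SameCycle.exists_nat_pow_eq hpq
    subst hi
    clear hpq
    induction i with
    | zero => rfl
    | succ i ih => rw [ih, pow_succ', Equiv.Perm.mul_apply, step]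
  · rintro ⟨x⟩
    by_cases h : ε x = true
    · simp [toF, h]
    · change Quotient.lift _ _ (toF x) = _
      simp only [toF, dif_neg h]
      exact (Quot.sound (r := fun x y => y = e x ∨ y = m x) (Or.inl rfl)).symm
  · rintro ⟨p⟩
    change toF p.1 = _
    simp [toF, p.2]
    rfl

/-- The change of one of two involutions that exchange the colors, on the first color class. -/
def colorChange (hm : Function.Involutive m) (hm' : Function.Involutive m')
    (hεm : ∀ x, ε (m x) = !ε x) (hεm' : ∀ x, ε (m' x) = !ε x) :
    Equiv.Perm {x // ε x = true} where
  toFun x := ⟨m (m' x), by rw [hεm, hεm', x.2]; rfl⟩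
  invFun x := ⟨m' (m x), by rw [hεm', hεm, x.2]; rfl⟩
  left_inv x := by simp [hm (m' x), hm' x.1]
  right_inv x := by simp [hm' (m x), hm x.1]

/-- Since `m ∘ e = (m ∘ m') ∘ (m' ∘ e)`, the signs multiply; the size of the color class enters both
sides equally and cancels. -/
theorem neg_one_pow_orbitNumber [Fintype X] [DecidableEq X] (he : Function.Involutive e)
    (hm : Function.Involutive m) (hm' : Function.Involutive m')
    (hεe : ∀ x, ε (e x) = !ε x) (hεm : ∀ x, ε (m x) = !ε x) (hεm' : ∀ x, ε (m' x) = !ε x) :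
    (-1 : ℤˣ) ^ orbitNumber e m =
      Equiv.Perm.sign (colorChange hm hm' hεm hεm') * (-1) ^ orbitNumber e m' := by
  have h : colorPerm he hm hεe hεm = colorChange hm hm' hεm hεm' * colorPerm he hm' hεe hεm' := by
    ext x
    simp [colorPerm, colorChange, hm' (e x)]
  have h1 := sign_eq_neg_one_pow_orbits (colorPerm he hm hεe hεm)
  have h2 := sign_eq_neg_one_pow_orbits (colorPerm he hm' hεe hεm')
  rw [← orbitNumber_eq he hm hεe hεm, pow_add] at h1
  rw [← orbitNumber_eq he hm' hεe hεm', pow_add] at h2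
  rw [h, Equiv.Perm.sign_mul, h2] at h1
  rw [mul_left_comm] at h1
  exact (mul_left_cancel h1).symm

end Bicolored

/-- Two points joined at four-valent vertices as prescribed by `χ`, and at bivalent ones by `t`. -/
def vertexPairing {W M : Type*} (t : M → M) (χ : W → Fin 2) : (W × Fin 4) ⊕ M → (W × Fin 4) ⊕ M
  | .inl (w, i) => .inl (w, TangleDiagram.fundamental (χ w) i)
  | .inr x => .inr (t x)

section FourValent

variable {W M : Type*} {t : M → M} {e : (W × Fin 4) ⊕ M → (W × Fin 4) ⊕ M}
  {ε : (W × Fin 4) ⊕ M → Bool}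

theorem vertexPairing_involutive (ht : Function.Involutive t) (χ : W → Fin 2) :
    Function.Involutive (vertexPairing t χ) := by
  rintro (⟨w, i⟩ | x)
  · simp [vertexPairing, TangleDiagram.fundamental_invol]
  · simp [vertexPairing, ht x]

theorem bool_alternating_apply (b : Fin 4 → Bool) (h : ∀ i, b (i + 1) = !b i) :
    ∀ s i, b (TangleDiagram.fundamental s i) = !b i := by
  revert b; decide

theorem color_vertexPairing (hεt : ∀ x, ε (.inr (t x)) = !ε (.inr x))
    (hεw : ∀ w i, ε (.inl (w, i + 1)) = !ε (.inl (w, i))) (χ : W → Fin 2) (x) :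
    ε (vertexPairing t χ x) = !ε x := by
  rcases x with ⟨w, i⟩ | x
  · exact bool_alternating_apply (fun i => ε (.inl (w, i))) (hεw w) (χ w) i
  · exact hεt x

/-- The two planar pairings compose to `i ↦ i + 2`, and opposite ends have the same color. On one
color class a switch is thus a single transposition. -/
theorem exists_perm_fin_four : ∀ (b : Fin 4 → Bool), (∀ i, b (i + 1) = !b i) → ∀ s : Fin 2,
    ∃ τ : Equiv.Perm (Fin 4), Equiv.Perm.sign τ = (-1) ^ (s : ℕ) ∧
      ∀ i, τ i = if b i = true then TangleDiagram.fundamental s (TangleDiagram.fundamental 0 i)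
        else i := by
  intro b h s
  have h0 := h 0
  have h1 := h 1
  have h2 := h 2
  have h3 := h 3
  simp only [Fin.isValue, zero_add, Fin.reduceAdd] at h0 h1 h2 h3
  fin_cases s
  · refine ⟨1, by simp, fun i => ?_⟩
    simp [TangleDiagram.fundamental_invol]
  · cases hb : b 0
    · refine ⟨Equiv.swap 1 3, by decide, fun i => ?_⟩
      rw [hb] at h0
      rw [h0] at h1
      rw [h1] at h2
      fin_cases i <;> simp [hb, h0, h1, h2] <;> decide
    · refine ⟨Equiv.swap 0 2, by decide, fun i => ?_⟩
      rw [hb] at h0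
      rw [h0] at h1
      rw [h1] at h2
      fin_cases i <;> simp [hb, h0, h1, h2] <;> decide

theorem neg_one_pow_orbitNumber_vertexPairing [Fintype W] [Finite M]
    (he : Function.Involutive e) (ht : Function.Involutive t)
    (hεe : ∀ x, ε (e x) = !ε x) (hεt : ∀ x, ε (.inr (t x)) = !ε (.inr x))
    (hεw : ∀ w i, ε (.inl (w, i + 1)) = !ε (.inl (w, i))) (χ : W → Fin 2) :
    (-1 : ℤˣ) ^ orbitNumber e (vertexPairing t χ) =
      (-1) ^ (∑ w, (χ w : ℕ)) * (-1) ^ orbitNumber e (vertexPairing t fun _ : W => 0) := by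
  classical
  have := Fintype.ofFinite M
  rw [neg_one_pow_orbitNumber he (vertexPairing_involutive ht χ)
    (vertexPairing_involutive ht fun _ => 0) hεe (color_vertexPairing hεt hεw χ)
    (color_vertexPairing hεt hεw fun _ => 0)]
  congr 1
  choose τ hτ hτ' using fun w => exists_perm_fin_four (fun i => ε (.inl (w, i))) (hεw w) (χ w)
  rw [← Equiv.Perm.sign_ofSubtype]
  -- Extending by the identity to the other color keeps the sign and turns the change into a product
  -- of local permutations, one for each four-valent vertex.
  have key : Equiv.Perm.ofSubtype (colorChange (vertexPairing_involutive ht χ)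
      (vertexPairing_involutive ht fun _ => 0) (color_vertexPairing hεt hεw χ)
      (color_vertexPairing hεt hεw fun _ => 0)) =
      Equiv.Perm.sumCongr (Equiv.prodCongrRight τ : Equiv.Perm (W × Fin 4)) (1 : Equiv.Perm M) := by
    ext1 x
    by_cases hx : ε x = true
    · rw [Equiv.Perm.ofSubtype_apply_of_mem (p := fun x => ε x = true) _ hx]
      rcases x with ⟨w, i⟩ | x
      · simp [colorChange, vertexPairing, hτ', hx]
      · simp [colorChange, vertexPairing, ht x]
    · rw [Equiv.Perm.ofSubtype_apply_of_not_mem (p := fun x => ε x = true) _ hx]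
      rcases x with ⟨w, i⟩ | x
      · simp [hτ', hx]
      · simp
  rw [key, Equiv.Perm.sign_sumCongr, Equiv.Perm.sign_prodCongrRight]
  simp [hτ, Finset.prod_pow_eq_pow_sum]

end FourValent

/-! ### Mod 2 cohomology of a graph of genus zero -/

section Euler

variable {X : Type*} {r e : X → X}

/-- The function on the orbits of an involution `e` whose value at the orbit of `x` is the sum of
the values at `x` and at `e x` of a function on the orbits of `p`. -/
def edgeSum (p : X → X) (he : Function.Involutive e) :
    ((Quot fun x y : X => y = p x) → ZMod 2) →ₗ[ZMod 2]
      ((Quot fun x y : X => y = e x) → ZMod 2) where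
  toFun g := Quot.lift (fun x => g (Quot.mk _ x) + g (Quot.mk _ (e x))) (by
    rintro x _ rfl
    rw [he x, add_comm])
  map_add' g h := by
    ext ⟨x⟩
    simp only [Pi.add_apply]
    ring
  map_smul' c g := by
    ext ⟨x⟩
    simp only [Pi.smul_apply, smul_eq_mul, RingHom.id_apply]
    ring

@[simp]
theorem edgeSum_mk (p : X → X) (he : Function.Involutive e) (g) (x : X) :
    edgeSum p he g (Quot.mk _ x) = g (Quot.mk _ x) + g (Quot.mk _ (e x)) := rfl

/-- A function in the kernel is constant across edges as well as on the orbits of `p`, so by `hp` it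
is a function on components. This serves for vertices (`p = r`) and for faces (`p = r ∘ e`). -/
theorem finrank_ker_edgeSum_le [Finite X] (p : X → X) (he : Function.Involutive e)
    (hp : ∀ g : X → ZMod 2, (∀ x, g (p x) = g x) → (∀ x, g (e x) = g x) → ∀ x, g (r x) = g x) :
    Module.finrank (ZMod 2) (LinearMap.ker (edgeSum p he)) ≤
      Nat.card (Quot fun x y : X => y = r x ∨ y = e x) := by
  classical
  have := Fintype.ofFinite (Quot fun x y : X => y = r x ∨ y = e x)
  have key : ∀ g : LinearMap.ker (edgeSum p he), ∀ x y, (y = r x ∨ y = e x) →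
      g.1 (Quot.mk _ x) = g.1 (Quot.mk _ y) := by
    intro g
    have h1 : ∀ x, g.1 (Quot.mk _ (e x)) = g.1 (Quot.mk _ x) := by
      intro x
      have := congrFun (LinearMap.mem_ker.1 g.2) (Quot.mk _ x)
      rw [edgeSum_mk] at this
      exact (CharTwo.add_eq_zero.1 this).symm
    have h2 : ∀ x, g.1 (Quot.mk _ (p x)) = g.1 (Quot.mk _ x) :=
      fun x => congrArg g.1 (Quot.sound (r := fun x y => y = p x) rfl).symm
    rintro x y (rfl | rfl)
    · exact (hp (fun x => g.1 (Quot.mk _ x)) h2 h1 x).symm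
    · exact (h1 x).symm
  let ι : LinearMap.ker (edgeSum p he) →ₗ[ZMod 2]
      ((Quot fun x y : X => y = r x ∨ y = e x) → ZMod 2) :=
    { toFun g := Quot.lift (fun x => g.1 (Quot.mk _ x)) (key g)
      map_add' g h := by ext ⟨x⟩; rfl
      map_smul' c g := by ext ⟨x⟩; rfl }
  have hι : Function.Injective ι := by
    intro g h hgh
    ext ⟨x⟩
    exact congrFun hgh (Quot.mk _ x)
  refine (LinearMap.finrank_le_finrank_of_injective hι).trans ?_
  rw [Module.finrank_fintype_fun_eq_card, Nat.card_eq_fintype_card]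

theorem card_le_finrank_range_edgeSum_add [Finite X] (p : X → X) (he : Function.Involutive e)
    (hp : ∀ g : X → ZMod 2, (∀ x, g (p x) = g x) → (∀ x, g (e x) = g x) → ∀ x, g (r x) = g x) :
    Nat.card (Quot fun x y : X => y = p x) ≤
      Module.finrank (ZMod 2) (LinearMap.range (edgeSum p he)) +
        Nat.card (Quot fun x y : X => y = r x ∨ y = e x) := by
  classical
  have := Fintype.ofFinite (Quot fun x y : X => y = p x)
  have h := LinearMap.finrank_range_add_finrank_ker (edgeSum p he)
  rw [Module.finrank_fintype_fun_eq_card, ← Nat.card_eq_fintype_card] at h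
  rw [← h]
  exact Nat.add_le_add_left (finrank_ker_edgeSum_le p he hp) _

/-- A sum over edges, as a sum over the ends of the edges. -/
theorem sum_mul_edgeSum [Fintype X] (p : X → X) (he : Function.Involutive e)
    (hne : ∀ x, e x ≠ x) [Fintype (Quot fun x y : X => y = e x)]
    (c : (Quot fun x y : X => y = e x) → ZMod 2) (g) :
    ∑ q, c q * edgeSum p he g q = ∑ x, c (Quot.mk _ x) * g (Quot.mk _ x) := by
  classical
  rw [← Finset.sum_fiberwise_of_maps_to (s := Finset.univ) (t := Finset.univ)
    (g := fun x => Quot.mk (fun x y : X => y = e x) x) (fun _ _ => Finset.mem_univ _)]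
  refine Finset.sum_congr rfl ?_
  rintro ⟨x⟩ -
  have hs : (Finset.univ.filter fun y => Quot.mk (fun x y : X => y = e x) y = Quot.mk _ x) =
      {x, e x} := by
    ext y
    simp only [Finset.mem_filter, Finset.mem_univ, true_and, Finset.mem_insert,
      Finset.mem_singleton]
    constructor
    · intro h
      have : ∀ a b, Quot.mk (fun x y : X => y = e x) a = Quot.mk _ b → b = a ∨ b = e a := by
        intro a b hab
        have := Quot.eqvGen_exact hab
        induction this with
        | rel a b h => exact Or.inr h
        | refl a => exact Or.inl rfl
        | symm a b _ ih =>
          rcases ih (Quot.eqvGen_sound ‹_›) with h | h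
          · exact Or.inl h.symm
          · exact Or.inr (by rw [h, he a])
        | trans a b c h1 h2 ih1 ih2 =>
          rcases ih1 (Quot.eqvGen_sound h1) with rfl | rfl
          · exact ih2 (Quot.eqvGen_sound h2)
          · rcases ih2 (Quot.eqvGen_sound h2) with h | h
            · exact Or.inr h
            · exact Or.inl (by rw [h, he a])
      exact this x y h.symm
    · rintro (rfl | rfl)
      · rfl
      · exact (Quot.sound (r := fun x y => y = e x) rfl).symm
  rw [hs, Finset.sum_pair (hne x).symm, edgeSum_mk, mul_add]
  have : Quot.mk (fun x y : X => y = e x) (e x) = Quot.mk _ x :=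
    (Quot.sound (r := fun x y => y = e x) rfl).symm
  rw [this]

/-- In genus zero, cocycles are coboundaries. -/
theorem exists_coloring_of_euler [Finite X] (hr : Function.Bijective r)
    (he : Function.Involutive e) (hne : ∀ x, e x ≠ x)
    (heuler : Nat.card (Quot fun x y : X => y = r x) + Nat.card (Quot fun x y : X => y = r (e x)) =
      Nat.card (Quot fun x y : X => y = e x) +
        2 * Nat.card (Quot fun x y : X => y = r x ∨ y = e x))
    (ε₀ : X → ZMod 2) (hε₀ : ∀ x, ε₀ (r x) = ε₀ x + 1) :
    ∃ ε : X → ZMod 2, (∀ x, ε (r x) = ε x + 1) ∧ ∀ x, ε (e x) = ε x + 1 := by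
  classical
  have := Fintype.ofFinite X
  have := Fintype.ofFinite (Quot fun x y : X => y = e x)
  have := Fintype.ofFinite (Quot fun x y : X => y = r (e x))
  have two : ∀ a : ZMod 2, a + a = 0 := CharTwo.add_self_eq_zero
  -- `A` is the boundary matrix from faces to edges, so the kernel of its transpose consists of the
  -- 1-cocycles.
  set A := LinearMap.toMatrix' (edgeSum (fun x => r (e x)) he) with hA
  have hker : ∀ c, c ∈ LinearMap.ker (A.transpose).mulVecLin ↔
      ∀ g : (Quot fun x y : X => y = r (e x)) → ZMod 2,
        ∑ x, c (Quot.mk _ x) * g (Quot.mk _ x) = 0 := by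
    intro c
    rw [LinearMap.mem_ker, Matrix.mulVecLin_apply, Matrix.mulVec_transpose]
    have hdot : ∀ g : (Quot fun x y : X => y = r (e x)) → ZMod 2, (Matrix.vecMul c A) ⬝ᵥ g =
        ∑ x, c (Quot.mk _ x) * g (Quot.mk _ x) := by
      intro g
      rw [← Matrix.dotProduct_mulVec, ← sum_mul_edgeSum _ he hne]
      rw [hA, LinearMap.toMatrix'_mulVec]
      rfl
    constructor
    · intro h g
      rw [← hdot, h, zero_dotProduct]
    · intro h
      refine dotProduct_eq_zero _ fun g => ?_
      rw [hdot, h]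
  -- The case `d = 0` covers coboundaries of vertex functions, and `d = 1` the failure of an
  -- alternating coloring across edges. In both, the sum around the faces is twice a sum over all
  -- ends, because `r ∘ e` is a bijection.
  have hcocycle : ∀ (h : X → ZMod 2) (d : ZMod 2), (∀ x, h (r x) = h x + d) →
      ∀ c : (Quot fun x y : X => y = e x) → ZMod 2,
      (∀ x, c (Quot.mk _ x) = h (e x) + h x + d) →
      c ∈ LinearMap.ker (A.transpose).mulVecLin := by
    intro h d hd c hc
    rw [hker]
    intro g
    have h1 : ∀ x, c (Quot.mk _ x) * g (Quot.mk _ x) =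
        h (r (e x)) * g (Quot.mk _ (r (e x))) + h x * g (Quot.mk _ x) := by
      intro x
      have : Quot.mk (fun x y : X => y = r (e x)) (r (e x)) = Quot.mk _ x :=
        (Quot.sound (r := fun x y => y = r (e x)) rfl).symm
      rw [this, hc, hd]
      ring
    simp only [h1]
    rw [Finset.sum_add_distrib]
    have hb : Function.Bijective fun x => r (e x) := hr.comp he.bijective
    rw [hb.sum_comp fun x => h x * g (Quot.mk _ x)]
    exact two _
  have hle : LinearMap.range (edgeSum r he) ≤ LinearMap.ker (A.transpose).mulVecLin := by
    rintro _ ⟨g, rfl⟩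
    refine hcocycle (fun x => g (Quot.mk _ x)) 0 ?_ _ ?_
    · intro x
      rw [add_zero]
      exact congrArg g (Quot.sound (r := fun x y => y = r x) rfl).symm
    · intro x
      rw [edgeSum_mk, add_zero, add_comm]
  -- With `V - E + F = 2 C`, cocycles have dimension at most `E - (F - C) = V - C`, and coboundaries
  -- at least `V - C`.
  have hdim : Module.finrank (ZMod 2) (LinearMap.ker (A.transpose).mulVecLin) ≤
      Module.finrank (ZMod 2) (LinearMap.range (edgeSum r he)) := by
    have h1 := card_le_finrank_range_edgeSum_add (r := r) r he fun g h _ => h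
    have h2 := card_le_finrank_range_edgeSum_add (r := r) (fun x => r (e x)) he fun g h h' x => by
      have := h (e x)
      rwa [he x, h'] at this
    have h3 := LinearMap.finrank_range_add_finrank_ker (A.transpose).mulVecLin
    have h4 : Module.finrank (ZMod 2) (LinearMap.range (A.transpose).mulVecLin) =
        Module.finrank (ZMod 2) (LinearMap.range (edgeSum (fun x => r (e x)) he)) := by
      change A.transpose.rank = _
      rw [Matrix.rank_transpose, Matrix.rank, hA, ← Matrix.toLin'_apply', Matrix.toLin'_toMatrix']
    rw [Module.finrank_fintype_fun_eq_card, ← Nat.card_eq_fintype_card] at h3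
    omega
  have heq := Submodule.eq_of_le_of_finrank_le hle hdim
  -- The defect of `ε₀` across edges is a cocycle, hence the coboundary of a vertex function `g`;
  -- adding `g` to `ε₀` removes the defect.
  have hmem : (Quot.lift (fun x => ε₀ (e x) + ε₀ x + 1) (by
      rintro x _ rfl
      rw [he x, add_comm (ε₀ x)]) : (Quot fun x y : X => y = e x) → ZMod 2) ∈
      LinearMap.range (edgeSum r he) := by
    rw [heq]
    exact hcocycle ε₀ 1 hε₀ _ fun x => rfl
  obtain ⟨g, hg⟩ := hmem
  refine ⟨fun x => ε₀ x + g (Quot.mk _ x), fun x => ?_, fun x => ?_⟩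
  · have : Quot.mk (fun x y : X => y = r x) (r x) = Quot.mk _ x :=
      (Quot.sound (r := fun x y => y = r x) rfl).symm
    dsimp only
    rw [hε₀, this]
    ring
  · have h := congrFun hg (Quot.mk _ x)
    rw [edgeSum_mk] at h
    change _ = ε₀ (e x) + ε₀ x + 1 at h
    linear_combination h - two (g (Quot.mk _ x)) + two (ε₀ (e x))

end Euler

/-! ### Dictionary orders -/

/-- A strictly increasing self-map of `Fin m` is the identity. Enumerations of dictionary orders can
therefore be identified by monotonicity alone. -/
theorem StrictMono.eq_orderIso_fin {m : ℕ} {α : Type*} [LinearOrder α] (φ : Fin m ≃o α)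
    {f : Fin m → α} (hf : StrictMono f) : f = φ := by
  have h : StrictMono fun i => φ.symm (f i) := φ.symm.strictMono.comp hf
  have hs : Function.Surjective fun i => φ.symm (f i) :=
    Finite.injective_iff_surjective.1 h.injective
  have hid : (fun i => φ.symm (f i)) = id := by
    refine (h.range_inj strictMono_id).1 ?_
    rw [hs.range_eq, Set.range_id]
  funext i
  rw [← φ.symm_apply_eq]
  exact congrFun hid i

/-- The digits of `i` in base two, the most significant of the `n` digits first. -/
def binaryDigits : (n : ℕ) → ℕ → Fin n → Fin 2
  | 0, _ => Fin.elim0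
  | n + 1, i =>
    if i < 2 ^ n then Fin.cons 0 (binaryDigits n i) else Fin.cons 1 (binaryDigits n (i - 2 ^ n))

theorem Fin.cons_lex_cons {n : ℕ} {a : Fin 2} {x y : Fin n → Fin 2} (h : toLex x < toLex y) :
    toLex (Fin.cons a x : Fin (n + 1) → Fin 2) < toLex (Fin.cons a y) := by
  obtain ⟨i, hi, hlt⟩ := h
  refine ⟨i.succ, fun j hj => ?_, ?_⟩
  · induction j using Fin.cases with
    | zero => rfl
    | succ j => exact hi j (Fin.succ_lt_succ_iff.1 hj)
  · exact hlt

theorem binaryDigits_lt (n : ℕ) {i j : ℕ} (hij : i < j) (hj : j < 2 ^ n) :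
    toLex (binaryDigits n i) < toLex (binaryDigits n j) := by
  induction n generalizing i j with
  | zero => simp at hj; omega
  | succ n ih =>
    rw [pow_succ] at hj
    by_cases h1 : j < 2 ^ n
    · rw [binaryDigits, binaryDigits, if_pos h1, if_pos (hij.trans h1)]
      exact Fin.cons_lex_cons (ih hij h1)
    · by_cases h2 : i < 2 ^ n
      · rw [binaryDigits, binaryDigits, if_neg h1, if_pos h2]
        exact ⟨0, fun j hj => absurd hj (Fin.not_lt_zero j), by
          change (0 : Fin 2) < 1
          decide⟩
      · rw [binaryDigits, binaryDigits, if_neg h1, if_neg h2]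
        exact Fin.cons_lex_cons (ih (by omega) (by omega))

theorem alpha_eq_binaryDigits (n : ℕ) (i : Fin (2 ^ n)) : alpha n i = binaryDigits n i := by
  have h : StrictMono fun i : Fin (2 ^ n) => toLex (binaryDigits n i) :=
    fun i j hij => binaryDigits_lt n hij j.2
  have h' := h.eq_orderIso_fin (dict (fun _ : Fin n => 2) (by simp))
  exact (congrArg ofLex (congrFun h' i)).symm

theorem tExponent_eq_sum_binaryDigits (n i : ℕ) :
    tExponent n i = ∑ j, (binaryDigits n i j : ℕ) := by
  induction n generalizing i with
  | zero => simp [tExponent]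
  | succ n ih =>
    rw [tExponent, binaryDigits]
    split_ifs with h
    · simp [Fin.sum_univ_succ, ih]
    · simp [Fin.sum_univ_succ, ih, add_comm]

theorem tExponent_eq_sum_alpha (n : ℕ) (i : Fin (2 ^ n)) :
    tExponent n i = ∑ j, (alpha n i j : ℕ) := by
  rw [alpha_eq_binaryDigits, tExponent_eq_sum_binaryDigits]

theorem alpha_strictMono (n : ℕ) : StrictMono fun i => toLex (alpha n i) :=
  (dict (fun _ : Fin n => 2) (by simp)).strictMono

theorem alpha_bijective (n : ℕ) : Function.Bijective (alpha n) :=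
  (dict (fun _ : Fin n => 2) (by simp)).bijective

theorem alphaPow_strictMono {n : ℕ} (k : Fin n → ℕ) :
    StrictMono fun i => toLex (alphaPow k i) :=
  (dict (fun j => 2 ^ k j) (Finset.prod_pow_eq_pow_sum _ _ _)).strictMono

theorem finSigmaFinEquiv_lt_of_lt {n : ℕ} {k : Fin n → ℕ} {j j' : Fin n} (h : j < j')
    (m : Fin (k j)) (m' : Fin (k j')) :
    finSigmaFinEquiv (⟨j, m⟩ : Σ j, Fin (k j)) < finSigmaFinEquiv ⟨j', m'⟩ := by
  rw [Fin.lt_def, finSigmaFinEquiv_apply, finSigmaFinEquiv_apply]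
  have h1 : ∀ j : Fin n, ∑ i : Fin j, k (Fin.castLE j.2.le i) =
      ∑ i ∈ Finset.range j, if h : i < n then k ⟨i, h⟩ else 0 := by
    intro j
    rw [Finset.sum_range]
    refine Finset.sum_congr rfl fun i _ => ?_
    rw [dif_pos (i.2.trans j.2)]
    rfl
  have h1j := h1 j
  have h1j' := h1 j'
  simp only
  rw [h1j, h1j']
  have h2 : ∑ i ∈ Finset.range (j + 1), (if h : i < n then k ⟨i, h⟩ else 0) ≤
      ∑ i ∈ Finset.range j', if h : i < n then k ⟨i, h⟩ else 0 :=
    Finset.sum_le_sum_of_subset (Finset.range_mono h)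
  rw [Finset.sum_range_succ, dif_pos j.2] at h2
  have := m.2
  simp only [Fin.eta] at h2
  omega

theorem finSigmaFinEquiv_lt_same {n : ℕ} {k : Fin n → ℕ} {j : Fin n} {m m' : Fin (k j)}
    (h : finSigmaFinEquiv (⟨j, m⟩ : Σ j, Fin (k j)) < finSigmaFinEquiv ⟨j, m'⟩) : m < m' := by
  rw [Fin.lt_def, finSigmaFinEquiv_apply, finSigmaFinEquiv_apply] at h
  exact Nat.lt_of_add_lt_add_left h

/-- Concatenating the words enumerated by `alphaPow` is strictly increasing: the first differing
letter lies in the first differing block. It must then be the dictionary enumeration of the long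
words. -/
theorem alpha_finSigmaFinEquiv {n : ℕ} (k : Fin n → ℕ) (c : Fin (2 ^ ∑ j, k j)) (j : Fin n)
    (m : Fin (k j)) :
    alpha (∑ j, k j) c (finSigmaFinEquiv ⟨j, m⟩) = alpha (k j) (alphaPow k c j) m := by
  let F : Fin (2 ^ ∑ j, k j) → Fin (∑ j, k j) → Fin 2 := fun c h =>
    alpha (k (finSigmaFinEquiv.symm h).1)
      (alphaPow k c (finSigmaFinEquiv.symm h).1) (finSigmaFinEquiv.symm h).2
  have hF : ∀ c j m, F c (finSigmaFinEquiv ⟨j, m⟩) = alpha (k j) (alphaPow k c j) m := by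
    intro c j m
    simp only [F]
    rw [Equiv.symm_apply_apply]
  have hf : StrictMono fun c => toLex (F c) := by
    intro a b hab
    obtain ⟨j, hj, hlt⟩ := alphaPow_strictMono k hab
    obtain ⟨m, hm, hlt'⟩ := alpha_strictMono (k j) hlt
    refine ⟨finSigmaFinEquiv ⟨j, m⟩, ?_, ?_⟩
    · intro h hh
      obtain ⟨⟨j', m'⟩, rfl⟩ := finSigmaFinEquiv.surjective h
      change F a _ = F b _
      rw [hF, hF]
      rcases lt_trichotomy j' j with h1 | rfl | h1
      · have : alphaPow k a j' = alphaPow k b j' := hj j' h1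
        rw [this]
      · exact hm m' (finSigmaFinEquiv_lt_same hh)
      · exact absurd hh (finSigmaFinEquiv_lt_of_lt h1 m m').not_gt
    · change F a _ < F b _
      rw [hF, hF]
      exact hlt'
  have h := congrFun (hf.eq_orderIso_fin (dict (fun _ : Fin (∑ j, k j) => 2) (by simp))) c
  have h2 : F c (finSigmaFinEquiv ⟨j, m⟩) = alpha (∑ j, k j) c (finSigmaFinEquiv ⟨j, m⟩) :=
    congrFun (congrArg ofLex h) _
  rw [← h2, hF]

/-! ### Coloring the ends of a planar diagram, and the parity of circles -/

theorem exists_bicoloring {X : Type*} {t : X → X} (ht : Function.Involutive t)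
    (hne : ∀ x, t x ≠ x) : ∃ δ : X → ZMod 2, ∀ x, δ (t x) = δ x + 1 := by
  classical
  let _ : LinearOrder X := IsWellOrder.linearOrder WellOrderingRel
  refine ⟨fun x => if x < t x then 0 else 1, fun x => ?_⟩
  simp only [ht x]
  rcases lt_or_gt_of_ne (hne x) with h | h
  · rw [if_pos h, if_neg h.not_gt]; rfl
  · rw [if_neg h.not_gt, if_pos h]; rfl

namespace TangleDiagram

variable {n : ℕ} (T : TangleDiagram n)

theorem rotation_bijective : Function.Bijective T.rotation := by
  refine Finite.injective_iff_bijective.1 ?_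
  rintro (⟨c, i⟩ | x | ⟨j, i⟩ | i) (⟨c', i'⟩ | x' | ⟨j', i'⟩ | i') h <;>
    simp only [rotation, reduceCtorEq, Sum.inl.injEq, Sum.inr.injEq, Prod.mk.injEq,
      add_left_inj, sub_left_inj] at h ⊢
  · exact h
  · exact T.through_involutive.injective h
  · exact h
  · exact h

variable {T}

/-- All vertices have valence four or two, so colors can alternate around each of them; genus zero
makes them alternate along the edges too. -/
theorem IsPlanar.exists_coloring (hT : T.IsPlanar) :
    ∃ ε : T.End → Bool, (∀ x, ε (T.edge x) = !ε x) ∧ ∀ x, ε (T.rotation x) = !ε x := by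
  obtain ⟨δ, hδ⟩ := exists_bicoloring T.through_involutive T.through_ne
  have h1 : ∀ i : Fin 4, (((i + 1 : Fin 4) : ℕ) : ZMod 2) = ((i : ℕ) : ZMod 2) + 1 := by decide
  have h2 : ∀ i : Fin 4, (((i - 1 : Fin 4) : ℕ) : ZMod 2) = ((i : ℕ) : ZMod 2) + 1 := by decide
  let ε₀ : T.End → ZMod 2 := fun
    | .inl (_, i) => (i : ℕ)
    | .inr (.inl x) => δ x
    | .inr (.inr (.inl (_, i))) => (i : ℕ)
    | .inr (.inr (.inr i)) => (i : ℕ)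
  have hε₀ : ∀ x, ε₀ (T.rotation x) = ε₀ x + 1 := by
    rintro (⟨c, i⟩ | x | ⟨j, i⟩ | i)
    · exact h1 i
    · exact hδ x
    · exact h1 i
    · exact h2 i
  obtain ⟨ε, hr, he⟩ := exists_coloring_of_euler T.rotation_bijective T.edge_involutive T.edge_ne
    hT ε₀ hε₀
  have h3 : ∀ a : ZMod 2, decide (a + 1 = 0) = !decide (a = 0) := by decide
  refine ⟨fun x => decide (ε x = 0), fun x => ?_, fun x => ?_⟩
  · simp only [he]; exact h3 _
  · simp only [hr]; exact h3 _

variable (T) in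
/-- The four-valent vertices of a diagram on the sphere: crossings, holes and the outside. -/
abbrev Vertex : Type := T.Crossing ⊕ (Fin n ⊕ Unit)

variable (T) in
/-- The ends of a diagram, sorted into ends at four-valent vertices and auxiliary points. -/
def endEquiv : (T.Vertex × Fin 4) ⊕ T.Mark ≃ T.End where
  toFun
    | .inl (.inl c, i) => .inl (c, i)
    | .inl (.inr (.inl j), i) => .inr (.inr (.inl (j, i)))
    | .inl (.inr (.inr _), i) => .inr (.inr (.inr i))
    | .inr x => .inr (.inl x)
  invFun
    | .inl (c, i) => .inl (.inl c, i)
    | .inr (.inl x) => .inr x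
    | .inr (.inr (.inl (j, i))) => .inl (.inr (.inl j), i)
    | .inr (.inr (.inr i)) => .inl (.inr (.inr ()), i)
  left_inv := by rintro (⟨c | j | u, i⟩ | x) <;> rfl
  right_inv := by rintro (⟨c, i⟩ | x | ⟨j, i⟩ | i) <;> rfl

variable (T) in
/-- The connections at the vertices that are made by the state `s`, the fillings `f` of the holes
and the closure `r`. -/
def vertexChoice (r : Fin 2) (f : Fin n → Fin 2) (s : T.Crossing → Splitting) : T.Vertex → Fin 2
  | .inl c => if s c = .A then 1 else 0
  | .inr (.inl j) => f j
  | .inr (.inr _) => 1 - r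

theorem endEquiv_vertexPairing (r : Fin 2) (f : Fin n → Fin 2) (s : T.Crossing → Splitting)
    (x : (T.Vertex × Fin 4) ⊕ T.Mark) :
    T.endEquiv (vertexPairing T.through (T.vertexChoice r f s) x) =
      (T.closeUp r f).smooth s (T.endEquiv x) := by
  rcases x with ⟨c | j | u, i⟩ | x
  · change (Sum.inl _ : T.End) = Sum.inl _
    simp only [vertexChoice]
    rcases s c with _ | _ <;> rfl
  · rfl
  · change (Sum.inr (Sum.inr (Sum.inr _)) : T.End) = Sum.inr (Sum.inr (Sum.inr _))
    simp only [vertexChoice]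
    fin_cases r <;> rfl
  · rfl

end TangleDiagram

theorem orbitNumber_congr {X Y : Type*} (φ : X ≃ Y) {e m : X → X} {e' m' : Y → Y}
    (he : ∀ x, φ (e x) = e' (φ x)) (hm : ∀ x, φ (m x) = m' (φ x)) :
    orbitNumber e m = orbitNumber e' m' := by
  refine Nat.card_congr (Quot.congr φ fun x y => ?_)
  rw [← he, ← hm, φ.apply_eq_iff_eq, φ.apply_eq_iff_eq]

namespace TangleDiagram

variable {n : ℕ} {T : TangleDiagram n}

/-- Crossings, holes and the outside are treated alike as four-valent vertices, and each switch of
pairing costs one sign. The unit `u` records the reference state. -/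
theorem IsPlanar.exists_neg_one_pow_circles (hT : T.IsPlanar) :
    ∃ u : ℤˣ, ∀ (r : Fin 2) (f : Fin n → Fin 2) (s : T.Crossing → Splitting),
      (-1 : ℤˣ) ^ (T.closeUp r f).circles s =
        u * (-1) ^ ((r : ℕ) + ∑ j, (f j : ℕ) + (Finset.univ.filter fun c => s c = .A).card) := by
  obtain ⟨ε, he, hr⟩ := hT.exists_coloring
  set φ := T.endEquiv
  have hr' : ∀ i, ε (.inr (.inr (.inr (i + 1)))) = !ε (.inr (.inr (.inr i))) := by
    intro i
    have := hr (.inr (.inr (.inr (i + 1))))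
    simp only [rotation, add_sub_cancel_right] at this
    rw [this, Bool.not_not]
  have key := fun χ => neg_one_pow_orbitNumber_vertexPairing
    (e := fun x => φ.symm (T.edge (φ x))) (t := T.through) (ε := fun x => ε (φ x))
    (fun x => by simp [T.edge_involutive (φ x)]) T.through_involutive (fun x => by simp [he])
    (fun x => hr (.inr (.inl x)))
    (by
      rintro (c | j | u) i
      · exact hr (.inl (c, i))
      · exact hr (.inr (.inr (.inl (j, i))))
      · exact hr' i) χ
  -- The extra `-1` appears because `closingArcs r` is the fundamental pairing of index `1 - r`.
  refine ⟨(-1) ^ orbitNumber (fun x => φ.symm (T.edge (φ x)))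
    (vertexPairing T.through fun _ : T.Vertex => 0) * -1, fun r f s => ?_⟩
  · have h := key (T.vertexChoice r f s)
    rw [orbitNumber_congr φ (e' := T.edge) (m' := (T.closeUp r f).smooth s) (fun x => by simp)
      (T.endEquiv_vertexPairing r f s)] at h
    refine h.trans ?_
    have h2 : (-1 : ℤˣ) ^ (((1 - r : Fin 2) : ℕ)) = -1 * (-1) ^ (r : ℕ) := by
      fin_cases r <;> decide
    rw [Fintype.sum_sum_type, Fintype.sum_sum_type]
    simp only [vertexChoice, Finset.univ_unique, Finset.sum_singleton]
    have h3 : ∑ c, ((if s c = .A then 1 else 0 : Fin 2) : ℕ) =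
        (Finset.univ.filter fun c => s c = .A).card := by
      rw [Finset.card_filter]
      refine Finset.sum_congr rfl fun c _ => ?_
      split_ifs <;> rfl
    rw [h3, pow_add, pow_add, h2, mul_comm, pow_add, pow_add]
    set a := (-1 : ℤˣ) ^ (Finset.univ.filter fun c => s c = .A).card
    set b := (-1 : ℤˣ) ^ ∑ j, (f j : ℕ)
    set d := (-1 : ℤˣ) ^ (r : ℕ)
    set g := (-1 : ℤˣ) ^ orbitNumber (fun x => φ.symm (T.edge (φ x)))
      (vertexPairing T.through fun _ : T.Vertex => 0)
    have : g * (a * (b * (-1 * d))) = (g * -1) * (d * b * a) := by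
      simp only [mul_comm, mul_left_comm, mul_assoc]
    exact this

end TangleDiagram

/-! ### The bracket at the eighth root of unity: integrality and uniqueness up to sign -/

/-- The factor that a split crossing contributes to the bracket. -/
noncomputable def Splitting.weight (a : ℂ) : Splitting → ℂ
  | .A => a
  | .B => a⁻¹

/-- The eighth root of unity at which brackets are evaluated. -/
noncomputable def rootEight : ℂ := Complex.exp (Complex.I * Real.pi / 4)

theorem rootEight_sq : rootEight ^ 2 = Complex.I := by
  rw [rootEight, ← Complex.exp_nat_mul]
  rw [show ((2 : ℕ) : ℂ) * (Complex.I * Real.pi / 4) = Real.pi / 2 * Complex.I by push_cast; ring]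
  exact Complex.exp_pi_div_two_mul_I

theorem rootEight_ne_zero : rootEight ≠ 0 := Complex.exp_ne_zero _

theorem rootEight_pow_eight : rootEight ^ 8 = 1 := by
  rw [show (8 : ℕ) = 2 * 4 from rfl, pow_mul, rootEight_sq, Complex.I_pow_four]

namespace LinkDiagram

theorem circles_pos (L : LinkDiagram) [Nonempty L.Mark] (s : L.State) : 0 < L.circles s := by
  obtain ⟨x⟩ := ‹Nonempty L.Mark›
  have : Nonempty (Quot fun x y => y = L.edge x ∨ y = L.smooth s x) := ⟨Quot.mk _ (.inr x)⟩
  exact Nat.card_pos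

open Classical in
theorem bracket_eq_sum (L : LinkDiagram) [Nonempty L.Mark] :
    L.bracket = ∑ s : L.State, (∏ c, (s c).weight rootEight) *
      (if L.circles s = 1 then 1 else 0) := by
  have hz : -rootEight ^ 2 - rootEight⁻¹ ^ 2 = 0 := by
    rw [inv_pow, rootEight_sq, Complex.inv_I]
    ring
  change ∑ s : L.State, rootEight ^ _ * rootEight⁻¹ ^ _ * (-rootEight ^ 2 - rootEight⁻¹ ^ 2) ^ _ = _
  rw [hz]
  refine Finset.sum_congr rfl fun s _ => ?_
  -- Positivity of `circles` matters: with truncated subtraction, zero circles would also give `0 ^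
  -- 0 = 1`.
  have h1 : (0 : ℂ) ^ (L.circles s - 1) = if L.circles s = 1 then 1 else 0 := by
    have := L.circles_pos s
    rw [zero_pow_eq]
    congr 1
    simp only [eq_iff_iff]
    omega
  rw [h1]
  congr 1
  rw [← Finset.prod_const, ← Finset.prod_const, Finset.prod_filter, Finset.prod_filter,
    ← Finset.prod_mul_distrib]
  refine Finset.prod_congr rfl fun c _ => ?_
  rcases s c with _ | _ <;> simp [Splitting.weight]

end LinkDiagram

theorem prod_weight_eq {C : Type*} [Fintype C] (s : C → Splitting) :
    ∏ c, (s c).weight rootEight = rootEight⁻¹ ^ Fintype.card C *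
      Complex.I ^ (Finset.univ.filter fun c => s c = .A).card := by
  have h : ∀ x : Splitting, x.weight rootEight =
      rootEight⁻¹ * if x = .A then Complex.I else 1 := by
    rintro (_ | _)
    · simp only [Splitting.weight, if_true, ← rootEight_sq]
      field_simp [rootEight_ne_zero]
    · simp [Splitting.weight]
  simp only [h, Finset.prod_mul_distrib]
  rw [Finset.prod_const, Finset.prod_ite]
  simp

theorem exists_int_I_pow (a t b : ℕ) (h : Even (a + t + b)) :
    ∃ z : ℤ, (z : ℂ) = Complex.I ^ a * ((-Complex.I) ^ t * Complex.I ^ b) := by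
  obtain ⟨l, hl⟩ := h
  refine ⟨(-1) ^ t * (-1) ^ l, ?_⟩
  push_cast
  rw [neg_pow, ← Complex.I_sq, ← pow_mul Complex.I 2 l]
  rw [show 2 * l = a + t + b by omega, pow_add, pow_add, Complex.I_sq]
  ring

namespace TangleDiagram

variable {n : ℕ} {T : TangleDiagram n}

instance (r : Fin 2) (f : Fin n → Fin 2) : Nonempty (T.closeUp r f).Mark :=
  ⟨(.inr (.inr 0) : T.Mark ⊕ ((Fin n × Fin 4) ⊕ Fin 4))⟩

open Classical in
theorem bracket_closeUp (T : TangleDiagram n) (r : Fin 2) (f : Fin n → Fin 2) :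
    (T.closeUp r f).bracket = ∑ s : T.Crossing → Splitting, (∏ c, (s c).weight rootEight) *
      (if (T.closeUp r f).circles s = 1 then 1 else 0) := by
  exact (T.closeUp r f).bracket_eq_sum

/-- For one-circle states the total exponent of `i`, up to a constant `κ` depending only on the
diagram, is even. Each such state then contributes a sign to an entry. -/
theorem IsPlanar.exists_integral (hT : T.IsPlanar) : ∃ M, M ∈ tangleInvariant T := by
  classical
  obtain ⟨u, hu⟩ := hT.exists_neg_one_pow_circles
  -- `-u` rather than `u`, because the circle number `1` is itself odd.
  obtain ⟨κ, hκ⟩ : ∃ κ : ℕ, (-1 : ℤˣ) ^ κ = -u := by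
    rcases Int.units_eq_one_or u with rfl | rfl
    · exact ⟨1, by simp⟩
    · exact ⟨0, by simp⟩
  have heven : ∀ (r : Fin 2) (f : Fin n → Fin 2) (s : T.Crossing → Splitting),
      (T.closeUp r f).circles s = 1 →
      Even (κ + ∑ j, (f j : ℕ) + ((r : ℕ) + (Finset.univ.filter fun c => s c = .A).card)) := by
    intro r f s hs
    have h := hu r f s
    rw [hs, pow_one] at h
    rw [← neg_one_pow_eq_one_iff_even (R := ℤˣ) (by decide)]
    rw [pow_add, pow_add, hκ, pow_add]
    rw [pow_add, pow_add] at h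
    have : ∀ a b c : ℤˣ, -u * a * (b * c) = -(u * (b * a * c)) := by
      intro a b c
      rw [neg_mul, neg_mul, mul_assoc, mul_left_comm a, mul_assoc]
    rw [this, ← h, neg_neg]
  have hint : ∀ (r : Fin 2) (c : Fin (2 ^ n)) (s : T.Crossing → Splitting), ∃ a : ℤ,
      (a : ℂ) = Complex.I ^ κ * ((-Complex.I) ^ tExponent n c *
        Complex.I ^ ((r : ℕ) + (Finset.univ.filter fun c => s c = .A).card)) *
        (if (T.closeUp r (alpha n c)).circles s = 1 then 1 else 0) := by
    intro r c s
    split_ifs with h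
    · obtain ⟨a, ha⟩ := exists_int_I_pow _ _ _ (heven r (alpha n c) s h)
      exact ⟨a, by rw [ha, tExponent_eq_sum_alpha, mul_one]⟩
    · exact ⟨0, by simp⟩
  choose a ha using hint
  -- The power of `rootEight` cancels the common factor of all state weights, and `I ^ κ` corrects
  -- the parity.
  refine ⟨Matrix.of fun r c => ∑ s, a r c s,
    rootEight ^ Fintype.card T.Crossing * Complex.I ^ κ, ?_, ?_⟩
  · rw [mul_pow, ← pow_mul, mul_comm _ 8, pow_mul, rootEight_pow_eight, ← pow_mul, mul_comm _ 8,
      show 8 * κ = 4 * (2 * κ) by ring, pow_mul Complex.I, Complex.I_pow_four]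
    simp
  · ext r c
    simp only [Matrix.map_apply, Matrix.of_apply, Matrix.smul_apply, bracketMatrix, smul_eq_mul,
      Int.cast_sum]
    rw [bracket_closeUp, Finset.mul_sum, Finset.mul_sum]
    refine Finset.sum_congr rfl fun s _ => ?_
    rw [ha, prod_weight_eq, pow_add, inv_pow]
    have : rootEight ^ Fintype.card T.Crossing ≠ 0 := pow_ne_zero _ rootEight_ne_zero
    field_simp

end TangleDiagram

/-- The ratio of two admissible scalars is an eighth root of unity. If the matrix has a nonzero
entry, comparing eighth powers of integers there forces the ratio to be `±1`; for the zero matrix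
the scalar is irrelevant. -/
theorem tangleInvariant_eq_signClass {n : ℕ} {T : TangleDiagram n}
    {M : Matrix (Fin 2) (Fin (2 ^ n)) ℤ} (hM : M ∈ tangleInvariant T) :
    tangleInvariant T = signClass M := by
  obtain ⟨z, hz, hzM⟩ := hM
  have hz0 : z ≠ 0 := by rintro rfl; simp at hz
  ext N
  simp only [signClass, Set.mem_insert_iff, Set.mem_singleton_iff]
  constructor
  · rintro ⟨w, hw, hwN⟩
    have hq : ∀ i j, (N i j : ℂ) = w / z * M i j := by
      intro i j
      have h1 := congrFun (congrFun hzM i) j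
      have h2 := congrFun (congrFun hwN i) j
      simp only [Matrix.map_apply, Matrix.smul_apply, smul_eq_mul] at h1 h2
      rw [h1, h2]
      field_simp
    have hpow : (w / z) ^ 8 = 1 := by rw [div_pow, hz, hw, div_one]
    by_cases hM0 : M = 0
    · left
      ext i j
      have := hq i j
      rw [hM0] at this
      simp at this
      rw [this, hM0]
      rfl
    · obtain ⟨i, j, hij⟩ : ∃ i j, M i j ≠ 0 := by
        by_contra! h
        exact hM0 (Matrix.ext h)
      have hij' : (M i j : ℂ) ≠ 0 := by exact_mod_cast hij
      have h8 : (N i j) ^ 8 = (M i j) ^ 8 := by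
        have : (N i j : ℂ) ^ 8 = (M i j : ℂ) ^ 8 := by rw [hq, mul_pow, hpow, one_mul]
        exact_mod_cast this
      have habs : N i j = M i j ∨ N i j = -M i j := by
        have : |N i j| ^ 8 = |M i j| ^ 8 := by rw [← abs_pow, ← abs_pow, h8]
        exact abs_eq_abs.1
          ((pow_left_inj₀ (abs_nonneg _) (abs_nonneg _) (by norm_num)).1 this)
      have hwz : w / z = 1 ∨ w / z = -1 := by
        have := hq i j
        rcases habs with h | h
        · left
          rw [h] at this
          exact mul_right_cancel₀ hij' (by rw [← this, one_mul])
        · right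
          rw [h] at this
          exact mul_right_cancel₀ hij' (by rw [← this]; push_cast; ring)
      rcases hwz with h | h
      · left
        ext i j
        have := hq i j
        rw [h, one_mul] at this
        exact_mod_cast this
      · right
        ext i j
        have := hq i j
        rw [h, neg_one_mul] at this
        rw [Matrix.neg_apply]
        exact_mod_cast this
  · rintro (rfl | rfl)
    · exact ⟨z, hz, hzM⟩
    · refine ⟨-z, by rw [Even.neg_pow (by decide), hz], ?_⟩
      rw [neg_smul, ← hzM]
      ext i j
      simp

theorem TangleDiagram.IsPlanar.tangleInvariant_mem_PM {n : ℕ} {T : TangleDiagram n}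
    (hT : T.IsPlanar) : tangleInvariant T ∈ PM 2 (2 ^ n) := by
  obtain ⟨M, hM⟩ := hT.exists_integral
  exact ⟨M, (tangleInvariant_eq_signClass hM).symm⟩

/-! ### Connectedness through invariant sets -/

/-- A set that is mapped to itself by two maps. -/
def PairInvariant {X : Type*} (e m : X → X) (U : Set X) : Prop :=
  (∀ x ∈ U, e x ∈ U) ∧ ∀ x ∈ U, m x ∈ U

section PairInvariant

variable {X : Type*} {e m m' : X → X}

theorem pairInvariant_orbit (he : Function.Involutive e) (hm : Function.Involutive m) (x : X) :
    PairInvariant e m {y | Quot.mk (fun x y => y = e x ∨ y = m x) y = Quot.mk _ x} := by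
  refine ⟨fun y hy => ?_, fun y hy => ?_⟩
  · exact (Quot.sound (r := fun x y => y = e x ∨ y = m x) (Or.inl (he y).symm)).trans hy
  · exact (Quot.sound (r := fun x y => y = e x ∨ y = m x) (Or.inr (hm y).symm)).trans hy

/-- Invariant sets restrict to the pieces of a composite and can be glued from them, so this form of
connectedness avoids following strands across the pieces. -/
theorem orbitNumber_eq_one_iff [Nonempty X] (he : Function.Involutive e)
    (hm : Function.Involutive m) :
    orbitNumber e m = 1 ↔ ∀ U, PairInvariant e m U → U.Nonempty → U = Set.univ := by
  constructor
  · rintro h U ⟨h1, h2⟩ ⟨x, hx⟩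
    have hs := (Nat.card_eq_one_iff_unique.1 h).1
    let F : Quot (fun x y => y = e x ∨ y = m x) → Prop := Quot.lift (fun x => x ∈ U) (by
      rintro a b (rfl | rfl)
      · exact propext ⟨h1 a, fun h => by simpa [he a] using h1 _ h⟩
      · exact propext ⟨h2 a, fun h => by simpa [hm a] using h2 _ h⟩)
    refine Set.eq_univ_of_forall fun y => ?_
    have hq : Quot.mk (fun x y => y = e x ∨ y = m x) y = Quot.mk _ x := hs.elim _ _
    exact (congrArg F hq).mpr hx
  · intro h
    obtain ⟨x⟩ := ‹Nonempty X›
    refine Nat.card_eq_one_iff_unique.2 ⟨⟨?_⟩, ⟨Quot.mk _ x⟩⟩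
    rintro ⟨a⟩ ⟨b⟩
    have hb := h _ (pairInvariant_orbit he hm b) ⟨b, rfl⟩
    exact (Set.ext_iff.1 hb a).2 trivial

theorem orbitNumber_eq_of_pairInvariant_iff (he : Function.Involutive e)
    (hm : Function.Involutive m) (hm' : Function.Involutive m')
    (h : ∀ U, PairInvariant e m U ↔ PairInvariant e m' U) :
    orbitNumber e m = orbitNumber e m' := by
  refine Nat.card_congr ⟨Quot.lift (fun x => Quot.mk _ x) ?_, Quot.lift (fun x => Quot.mk _ x) ?_,
    ?_, ?_⟩
  · rintro x _ (rfl | rfl)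
    · exact Quot.sound (Or.inl rfl)
    · exact (((h _).2 (pairInvariant_orbit he hm' x)).2 x rfl).symm
  · rintro x _ (rfl | rfl)
    · exact Quot.sound (Or.inl rfl)
    · exact (((h _).1 (pairInvariant_orbit he hm x)).2 x rfl).symm
  · rintro ⟨x⟩; rfl
  · rintro ⟨x⟩; rfl

end PairInvariant

namespace LinkDiagram

theorem smooth_involutive (L : LinkDiagram) (s : L.State) : Function.Involutive (L.smooth s) := by
  have h : ∀ (a : Splitting) (i : Fin 4), a.reconnect (a.reconnect i) = i := by
    rintro (_ | _) <;> decide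
  rintro (⟨c, i⟩ | x)
  · simp [smooth, h]
  · simp [smooth, L.through_involutive x]

end LinkDiagram

namespace TangleDiagram

variable {n : ℕ} {T : TangleDiagram n}

/-- A set of ends that is a union of strands of the diagram split according to `s`, if strands stop
at the boundary circles. -/
structure LocalInvariant (T : TangleDiagram n) (s : T.Crossing → Splitting) (U : Set T.End) :
    Prop where
  edge : ∀ x ∈ U, T.edge x ∈ U
  crossing : ∀ c i, (.inl (c, i) : T.End) ∈ U → (.inl (c, (s c).reconnect i) : T.End) ∈ U
  mark : ∀ x, (.inr (.inl x) : T.End) ∈ U → (.inr (.inl (T.through x)) : T.End) ∈ U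

/-- A set of ends that is compatible with the filling `f` of the holes. -/
def HolesInvariant (T : TangleDiagram n) (f : Fin n → Fin 2) (U : Set T.End) : Prop :=
  ∀ j i, (.inr (.inr (.inl (j, i))) : T.End) ∈ U →
    (.inr (.inr (.inl (j, fundamental (f j) i))) : T.End) ∈ U

/-- The end at the `i`-th marked point of the outer circle. -/
def outer (T : TangleDiagram n) (i : Fin 4) : T.End := .inr (.inr (.inr i))

/-- A set of ends that is compatible with the closure `r`. -/
def OuterInvariant (T : TangleDiagram n) (r : Fin 2) (U : Set T.End) : Prop :=
  ∀ i, T.outer i ∈ U → T.outer (closingArcs r i) ∈ U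

theorem pairInvariant_closeUp_iff (r : Fin 2) (f : Fin n → Fin 2) (s : T.Crossing → Splitting)
    (U : Set T.End) : PairInvariant T.edge ((T.closeUp r f).smooth s) U ↔
      T.LocalInvariant s U ∧ T.HolesInvariant f U ∧ T.OuterInvariant r U := by
  constructor
  · rintro ⟨h1, h2⟩
    exact ⟨⟨h1, fun c i h => h2 (.inl (c, i)) h, fun x h => h2 (.inr (.inl x)) h⟩,
      fun j i h => h2 (.inr (.inr (.inl (j, i)))) h, fun i h => h2 (.inr (.inr (.inr i))) h⟩
  · rintro ⟨⟨h1, h2, h3⟩, h4, h5⟩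
    refine ⟨h1, ?_⟩
    rintro (⟨c, i⟩ | x | ⟨j, i⟩ | i) hx
    · exact h2 c i hx
    · exact h3 x hx
    · exact h4 j i hx
    · exact h5 i hx

theorem circles_eq_one_iff (r : Fin 2) (f : Fin n → Fin 2) (s : T.Crossing → Splitting) :
    (T.closeUp r f).circles s = 1 ↔ ∀ U, T.LocalInvariant s U → T.HolesInvariant f U →
      T.OuterInvariant r U → U.Nonempty → U = Set.univ := by
  have : Nonempty T.End := ⟨T.outer 0⟩
  refine (orbitNumber_eq_one_iff (e := T.edge) (m := (T.closeUp r f).smooth s) T.edge_involutive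
    (LinkDiagram.smooth_involutive _ _)).trans ?_
  simp only [pairInvariant_closeUp_iff, and_imp]

theorem reconnect_invol : ∀ (a : Splitting) (i : Fin 4), a.reconnect (a.reconnect i) = i := by
  rintro (_ | _) <;> decide

variable {f : Fin n → Fin 2} {s : T.Crossing → Splitting} {U V : Set T.End}

theorem LocalInvariant.compl (h : T.LocalInvariant s U) : T.LocalInvariant s Uᶜ where
  edge x hx h' := hx (by simpa [T.edge_involutive x] using h.edge _ h')
  crossing c i hx h' := hx (by simpa [reconnect_invol] using h.crossing _ _ h')
  mark x hx h' := hx (by simpa [T.through_involutive x] using h.mark _ h')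

theorem LocalInvariant.inter (h : T.LocalInvariant s U) (h' : T.LocalInvariant s V) :
    T.LocalInvariant s (U ∩ V) where
  edge x hx := ⟨h.edge x hx.1, h'.edge x hx.2⟩
  crossing c i hx := ⟨h.crossing c i hx.1, h'.crossing c i hx.2⟩
  mark x hx := ⟨h.mark x hx.1, h'.mark x hx.2⟩

theorem HolesInvariant.compl (h : T.HolesInvariant f U) : T.HolesInvariant f Uᶜ :=
  fun j i hx h' => hx (by simpa [fundamental_invol] using h _ _ h')

theorem HolesInvariant.inter (h : T.HolesInvariant f U) (h' : T.HolesInvariant f V) :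
    T.HolesInvariant f (U ∩ V) :=
  fun j i hx => ⟨h j i hx.1, h' j i hx.2⟩

theorem OuterInvariant.compl {r : Fin 2} (h : T.OuterInvariant r U) : T.OuterInvariant r Uᶜ :=
  fun i hx h' => hx (by simpa [closingArcs_invol] using h _ h')

/-- A union of strands contains as many outer ends of either color. -/
theorem IsPlanar.outer_balanced (hT : T.IsPlanar) (hU : T.LocalInvariant s U)
    (hf : T.HolesInvariant f U) :
    (T.outer 0 ∈ U ∧ T.outer 2 ∈ U ↔ T.outer 1 ∈ U ∧ T.outer 3 ∈ U) ∧
      (T.outer 0 ∈ U ∨ T.outer 2 ∈ U ↔ T.outer 1 ∈ U ∨ T.outer 3 ∈ U) := by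
  classical
  have := Fintype.ofFinite T.Mark
  obtain ⟨ε, he, hr⟩ := hT.exists_coloring
  -- The closure `0` is an arbitrary choice: it only completes `m` to an involution, and the outer
  -- ends are split off below.
  let m : T.End → T.End := (T.closeUp 0 f).smooth s
  have hsm : ∀ x, ε (m x) = !ε x := by
    have hrev : ∀ b : Fin 4 → Bool, (∀ i, b (i - 1) = !b i) → ∀ i, b (i + 1) = !b i := by decide
    have hsp : ∀ (b : Fin 4 → Bool), (∀ i, b (i + 1) = !b i) →
        ∀ (a : Splitting) i, b (a.reconnect i) = !b i := by
      rintro b hb (_ | _) i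
      · exact bool_alternating_apply b hb 1 i
      · exact bool_alternating_apply b hb 0 i
    rintro (⟨c, i⟩ | x | ⟨j, i⟩ | i)
    · exact hsp (fun i => ε (.inl (c, i))) (fun i => hr (.inl (c, i))) (s c) i
    · exact hr (.inr (.inl x))
    · exact bool_alternating_apply (fun i => ε (.inr (.inr (.inl (j, i)))))
        (fun i => hr (.inr (.inr (.inl (j, i))))) (f j) i
    · exact bool_alternating_apply (fun i => ε (.inr (.inr (.inr i))))
        (hrev (fun i => ε (.inr (.inr (.inr i)))) fun i => hr (.inr (.inr (.inr i)))) 1 i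
  have hinv : ∀ x, m (m x) = x := LinkDiagram.smooth_involutive (T.closeUp 0 f) s
  -- A signed count of the ends in `U` by color. It cancels along edges, and along `m` away from the
  -- outer circle, so the outer ends alone must cancel. Their colors alternate around the circle.
  let σ : T.End → ℤ := fun x => if x ∈ U then (if ε x = true then 1 else -1) else 0
  have hcancel : ∀ x y, (x ∈ U ↔ y ∈ U) → ε y = !ε x → σ x + σ y = 0 := by
    intro x y h1 h2
    simp only [σ, h1, h2]
    by_cases hy : y ∈ U <;> cases ε x <;> simp [hy]
  have hne : ∀ x y, ε y = !ε x → y ≠ x := by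
    rintro x _ h rfl
    simp at h
  have h1 : ∑ x, σ x = 0 := by
    refine Finset.sum_involution (fun x _ => T.edge x) (fun x _ => hcancel _ _ ?_ (he x))
      (fun x _ _ => T.edge_ne x) (fun _ _ => Finset.mem_univ _) (fun x _ => T.edge_involutive x)
    exact ⟨hU.edge x, fun h => by simpa [T.edge_involutive x] using hU.edge _ h⟩
  let Z : Finset T.End := Finset.univ.map ⟨T.outer, fun i j h => by simpa [outer] using h⟩
  have hZ : ∀ x, x ∈ Z ↔ ∃ i, T.outer i = x := by
    intro x
    simp only [Z, Finset.mem_map, Finset.mem_univ, true_and]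
    rfl
  have hZm : ∀ x, m x ∈ Z → x ∈ Z := by
    intro x hx
    rw [hZ] at hx ⊢
    obtain ⟨i, hi⟩ := hx
    refine ⟨closingArcs 0 i, ?_⟩
    rw [← hinv x, ← hi]
    rfl
  have hZc : ∀ x, x ∈ Zᶜ → m x ∈ Zᶜ := fun x hx => by
    rw [Finset.mem_compl] at hx ⊢
    exact fun h => hx (hZm x h)
  have hclosed : ∀ x ∈ Zᶜ, x ∈ U → m x ∈ U := by
    rintro (⟨c, i⟩ | x | ⟨j, i⟩ | i) hx hxU
    · exact hU.crossing c i hxU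
    · exact hU.mark x hxU
    · exact hf j i hxU
    · simp [hZ, outer] at hx
  have h2 : ∑ x ∈ Zᶜ, σ x = 0 := by
    refine Finset.sum_involution (fun x _ => m x)
      (fun x hx => hcancel _ _ ?_ (hsm x)) (fun x _ _ => hne _ _ (hsm x))
      hZc (fun x _ => hinv x)
    exact ⟨hclosed x hx, fun h => hinv x ▸ hclosed _ (hZc x hx) h⟩
  have h3 : ∑ i, σ (T.outer i) = 0 := by
    have := Finset.sum_add_sum_compl Z σ
    rw [h1, h2, add_zero, Finset.sum_map] at this
    exact this
  rw [Fin.sum_univ_four] at h3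
  have e3 : ε (T.outer 3) = !ε (T.outer 0) := hr (T.outer 0)
  have e2 : ε (T.outer 2) = !ε (T.outer 3) := hr (T.outer 3)
  have e1 : ε (T.outer 1) = !ε (T.outer 2) := hr (T.outer 2)
  simp only [σ, e1, e2, e3, Bool.not_not] at h3
  generalize ε (T.outer 0) = b at h3
  by_cases p0 : T.outer 0 ∈ U <;> by_cases p1 : T.outer 1 ∈ U <;>
    by_cases p2 : T.outer 2 ∈ U <;> by_cases p3 : T.outer 3 ∈ U <;>
    cases b <;> simp [p0, p1, p2, p3] at h3 ⊢

/-- Not all outer ends are on the same strand. -/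
theorem IsPlanar.exists_separating (hT : T.IsPlanar) (f : Fin n → Fin 2)
    (s : T.Crossing → Splitting) : ∃ U, T.LocalInvariant s U ∧ T.HolesInvariant f U ∧
      T.outer 0 ∈ U ∧ ∃ i, T.outer i ∉ U := by
  by_contra! hcon
  have hall : ∀ U, T.LocalInvariant s U → T.HolesInvariant f U → ∀ r, T.OuterInvariant r U := by
    intro U h1 h2 r i hi
    by_cases h0 : T.outer 0 ∈ U
    · exact hcon U h1 h2 h0 _
    · exact absurd hi (hcon Uᶜ h1.compl h2.compl h0 i)
  -- If no invariant set separated the outer ends, both closures would have the same invariant sets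
  -- and hence equally many circles, against the parity law.
  have heq : (T.closeUp 0 f).circles s = (T.closeUp 1 f).circles s := by
    refine orbitNumber_eq_of_pairInvariant_iff (e := T.edge) (m := (T.closeUp 0 f).smooth s)
      (m' := (T.closeUp 1 f).smooth s) T.edge_involutive (LinkDiagram.smooth_involutive _ _)
      (LinkDiagram.smooth_involutive _ _) fun U => ?_
    rw [pairInvariant_closeUp_iff, pairInvariant_closeUp_iff]
    constructor <;> exact fun ⟨h1, h2, _⟩ => ⟨h1, h2, hall U h1 h2 _⟩
  obtain ⟨u, hu⟩ := hT.exists_neg_one_pow_circles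
  have h0 := hu 0 f s
  have h1 := hu 1 f s
  rw [heq, h1] at h0
  have h2 := mul_left_cancel h0
  rw [pow_add, pow_add, pow_add, pow_add] at h2
  have h3 := mul_right_cancel (mul_right_cancel h2)
  simp at h3

/-- The strands that start at the outer circle form the fundamental tangle `p`: the set `K` contains
the strand that starts at `NW`, and not the other one. -/
structure HasType (T : TangleDiagram n) (f : Fin n → Fin 2) (s : T.Crossing → Splitting)
    (p : Fin 2) (K : Set T.End) : Prop where
  local_K : T.LocalInvariant s K
  holes_K : T.HolesInvariant f K
  outer_K : ∀ i, T.outer i ∈ K ↔ i = 0 ∨ i = fundamental p 0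
  outer_mem : ∀ U, T.LocalInvariant s U → T.HolesInvariant f U → ∀ i, T.outer i ∈ U →
    T.outer (fundamental p i) ∈ U

/-- A separating set is color-balanced on the outer circle, so it contains `NW` and exactly one of
its neighbors. This excludes the crossing pairing `NW – SE`, `SW – NE`. -/
theorem IsPlanar.exists_hasType (hT : T.IsPlanar) (f : Fin n → Fin 2)
    (s : T.Crossing → Splitting) : ∃ p K, T.HasType f s p K := by
  obtain ⟨K, h1, h2, h0, i, hi⟩ := hT.exists_separating f s
  have hK := hT.outer_balanced h1 h2
  have h13 : (T.outer 1 ∈ K ∧ T.outer 3 ∉ K ∨ T.outer 1 ∉ K ∧ T.outer 3 ∈ K) ∧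
      T.outer 2 ∉ K := by
    fin_cases i <;> simp only [Fin.reduceFinMk, Fin.zero_eta, Fin.mk_one, Fin.isValue] at hi <;>
      tauto
  obtain ⟨h13 | h13, h2'⟩ := h13
  · refine ⟨0, K, h1, h2, fun i => ?_, fun U hU hU' i => ?_⟩
    · fin_cases i <;> simp [h0, h13, h2', fundamental, pairV]
    · have a := (hT.outer_balanced (hU.inter h1) (hU'.inter h2)).2
      have b := (hT.outer_balanced (hU.inter h1.compl) (hU'.inter h2.compl)).2
      simp only [Set.mem_inter_iff, Set.mem_compl_iff, h0, h13, h2', not_true_eq_false,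
        not_false_eq_true, and_true, and_false, or_false, false_or] at a b
      fin_cases i
      · exact a.1
      · exact a.2
      · exact b.1
      · exact b.2
  · refine ⟨1, K, h1, h2, fun i => ?_, fun U hU hU' i => ?_⟩
    · fin_cases i <;> simp [h0, h13, h2', fundamental, pairH]
    · have a := (hT.outer_balanced (hU.inter h1) (hU'.inter h2)).2
      have b := (hT.outer_balanced (hU.inter h1.compl) (hU'.inter h2.compl)).2
      simp only [Set.mem_inter_iff, Set.mem_compl_iff, h0, h13, h2', not_true_eq_false,
        not_false_eq_true, and_true, and_false, or_false, false_or] at a b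
      fin_cases i
      · exact a.1
      · exact b.2
      · exact b.1
      · exact a.2

theorem HasType.eq_of_circles_eq_one {p r : Fin 2} {K : Set T.End} (h : T.HasType f s p K)
    (hc : (T.closeUp r f).circles s = 1) : r = p := by
  by_contra hne
  -- The closure with index other than `p` repeats the pairing `p` outside, so `K` stays invariant,
  -- yet it misses `SE`.
  have hcl : ∀ p r : Fin 2, r ≠ p → ∀ i, i = 0 ∨ i = fundamental p 0 →
      closingArcs r i = 0 ∨ closingArcs r i = fundamental p 0 := by decide
  have hnot : ∀ p : Fin 2, ¬ ((2 : Fin 4) = 0 ∨ 2 = fundamental p 0) := by decide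
  have := (circles_eq_one_iff r f s).1 hc K h.local_K h.holes_K
    (fun i hi => (h.outer_K _).2 (hcl p r hne i ((h.outer_K i).1 hi)))
    ⟨T.outer 0, (h.outer_K 0).2 (Or.inl rfl)⟩
  exact hnot p ((h.outer_K 2).1 (this ▸ Set.mem_univ _))

/-! ### Circles of a composite -/

section Composition

variable {k : Fin n → ℕ} {S : ∀ j, TangleDiagram (k j)}

/-- The part of a set of ends of a composite in the outer piece. -/
def basePart (T : TangleDiagram n) (S : ∀ j, TangleDiagram (k j)) (U : Set (T.comp S).End) :
    Set T.End := {y | ofPiece T S (.inl y) ∈ U}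

/-- The part of a set of ends of a composite in the `j`-th inserted piece. -/
def insertPart (T : TangleDiagram n) (S : ∀ j, TangleDiagram (k j)) (U : Set (T.comp S).End)
    (j : Fin n) : Set (S j).End := {y | ofPiece T S (.inr ⟨j, y⟩) ∈ U}

/-- The set of ends of a composite with given parts. -/
def joinParts (T : TangleDiagram n) (S : ∀ j, TangleDiagram (k j)) (U₀ : Set T.End)
    (U : ∀ j, Set (S j).End) : Set (T.comp S).End :=
  {x | Sum.elim (fun y => y ∈ U₀) (fun y => y.2 ∈ U y.1) (toPiece T S x)}

theorem basePart_joinParts (U₀ : Set T.End) (U : ∀ j, Set (S j).End) :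
    basePart T S (joinParts T S U₀ U) = U₀ := by
  ext y
  change Sum.elim _ _ (toPiece T S (ofPiece T S (.inl y))) ↔ _
  rw [toPiece_ofPiece]
  rfl

theorem insertPart_joinParts (U₀ : Set T.End) (U : ∀ j, Set (S j).End) (j : Fin n) :
    insertPart T S (joinParts T S U₀ U) j = U j := by
  ext y
  change Sum.elim _ _ (toPiece T S (ofPiece T S (.inr ⟨j, y⟩))) ↔ _
  rw [toPiece_ofPiece]
  rfl

theorem eq_univ_iff_parts (U : Set (T.comp S).End) :
    U = Set.univ ↔ basePart T S U = Set.univ ∧ ∀ j, insertPart T S U j = Set.univ := by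
  constructor
  · rintro rfl
    exact ⟨rfl, fun j => rfl⟩
  · rintro ⟨h1, h2⟩
    refine Set.eq_univ_of_forall fun x => ?_
    rw [← ofPiece_toPiece T S x]
    rcases toPiece T S x with y | ⟨j, y⟩
    · exact (Set.ext_iff.1 h1 y).2 trivial
    · exact (Set.ext_iff.1 (h2 j) y).2 trivial

theorem nonempty_iff_parts (U : Set (T.comp S).End) :
    U.Nonempty ↔ (basePart T S U).Nonempty ∨ ∃ j, (insertPart T S U j).Nonempty := by
  constructor
  · rintro ⟨x, hx⟩
    rw [← ofPiece_toPiece T S x] at hx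
    generalize toPiece T S x = z at hx
    rcases z with y | ⟨j, y⟩
    · exact Or.inl ⟨y, hx⟩
    · exact Or.inr ⟨j, y, hx⟩
  · rintro (⟨y, hy⟩ | ⟨j, y, hy⟩)
    · exact ⟨_, hy⟩
    · exact ⟨_, hy⟩

/-- The only interaction between pieces is at the gluing points, whose two sides must be both in or
both out. -/
theorem localInvariant_comp_iff (s : (T.comp S).Crossing → Splitting) (U : Set (T.comp S).End) :
    (T.comp S).LocalInvariant s U ↔ T.LocalInvariant (fun c => s (.inl c)) (basePart T S U) ∧
      (∀ j, (S j).LocalInvariant (fun c => s (.inr ⟨j, c⟩)) (insertPart T S U j)) ∧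
      ∀ j i, (.inr (.inr (.inl (j, i))) : T.End) ∈ basePart T S U ↔
        (S j).outer i ∈ insertPart T S U j := by
  constructor
  · rintro ⟨h1, h2, h3⟩
    refine ⟨⟨fun x hx => ?_, fun c i hx => h2 (.inl c) i hx, fun x hx => h3 (.inl x) hx⟩,
      fun j => ⟨fun x hx => ?_, fun c i hx => h2 (.inr ⟨j, c⟩) i hx,
        fun x hx => h3 (.inr (.inl ⟨j, x⟩)) hx⟩,
      fun j i => ⟨fun hx => h3 (.inr (.inr ((j, i), 0))) hx,
        fun hx => h3 (.inr (.inr ((j, i), 1))) hx⟩⟩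
    · have := h1 _ hx
      change ofPiece T S (pieceEdge T S (toPiece T S (ofPiece T S (.inl x)))) ∈ U at this
      rwa [toPiece_ofPiece] at this
    · have := h1 _ hx
      change ofPiece T S (pieceEdge T S (toPiece T S (ofPiece T S (.inr ⟨j, x⟩)))) ∈ U at this
      rwa [toPiece_ofPiece] at this
  · rintro ⟨h1, h2, h3⟩
    refine ⟨fun x hx => ?_, ?_, ?_⟩
    · change ofPiece T S (pieceEdge T S (toPiece T S x)) ∈ U
      rw [← ofPiece_toPiece T S x] at hx
      generalize toPiece T S x = z at hx
      rcases z with y | ⟨j, y⟩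
      · exact h1.edge y hx
      · exact (h2 j).edge y hx
    · rintro (c | ⟨j, c⟩) i hx
      · exact h1.crossing c i hx
      · exact (h2 j).crossing c i hx
    · rintro (x | ⟨j, x⟩ | ⟨⟨j, i⟩, b⟩) hx
      · exact h1.mark x hx
      · exact (h2 j).mark x hx
      · fin_cases b
        · exact (h3 j i).1 hx
        · exact (h3 j i).2 hx

theorem holesInvariant_comp_iff (g : Fin (∑ j, k j) → Fin 2) (U : Set (T.comp S).End) :
    (T.comp S).HolesInvariant g U ↔
      ∀ j, (S j).HolesInvariant (fun m => g (finSigmaFinEquiv ⟨j, m⟩)) (insertPart T S U j) := by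
  constructor
  · intro h j m i hx
    exact h (finSigmaFinEquiv ⟨j, m⟩) i hx
  · intro h m i hx
    obtain ⟨⟨j, m⟩, rfl⟩ := finSigmaFinEquiv.surjective m
    exact h j m i hx

theorem outerInvariant_comp_iff (r : Fin 2) (U : Set (T.comp S).End) :
    (T.comp S).OuterInvariant r U ↔ T.OuterInvariant r (basePart T S U) := Iff.rfl

/-- The split composite is a single circle if and only if this holds for the pieces, after the
other pieces have been replaced by fundamental tangles of the same type. -/
theorem circles_comp_eq_one_iff (r : Fin 2) (g : Fin (∑ j, k j) → Fin 2)
    (s : (T.comp S).Crossing → Splitting) {p : Fin n → Fin 2} {K : ∀ j, Set (S j).End}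
    (hp : ∀ j, (S j).HasType (fun m => g (finSigmaFinEquiv ⟨j, m⟩))
      (fun c => s (.inr ⟨j, c⟩)) (p j) (K j)) :
    ((T.comp S).closeUp r g).circles s = 1 ↔
      (T.closeUp r p).circles (fun c => s (.inl c)) = 1 ∧
      ∀ j, ((S j).closeUp (p j) fun m => g (finSigmaFinEquiv ⟨j, m⟩)).circles
        (fun c => s (.inr ⟨j, c⟩)) = 1 := by
  -- The pairing `p` inside and the closure `p` outside together join all four points into one
  -- circle.
  have hconn : ∀ p : Fin 2, ∀ P : Fin 4 → Bool, (∀ i, P i = true → P (fundamental p i) = true) →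
      (∀ i, P i = true → P (closingArcs p i) = true) → ∀ i i', P i = true → P i' = true := by decide
  have houter : ∀ j U, (S j).LocalInvariant (fun c => s (.inr ⟨j, c⟩)) U →
      (S j).HolesInvariant (fun m => g (finSigmaFinEquiv ⟨j, m⟩)) U →
      (S j).OuterInvariant (p j) U → ∀ i i', (S j).outer i ∈ U → (S j).outer i' ∈ U := by
    classical
    intro j U h1 h2 h3 i i'
    have := hconn (p j) (fun i => decide ((S j).outer i ∈ U))
      (fun i => by simpa using (hp j).outer_mem U h1 h2 i) (fun i => by simpa using h3 i) i i'
    simpa using this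
  refine (circles_eq_one_iff (T := T.comp S) r g s).trans (Iff.trans ?_ (and_congr
    (circles_eq_one_iff r p _) (forall_congr' fun j => circles_eq_one_iff (T := S j) _ _ _)).symm)
  constructor
  · intro h
    refine ⟨fun U h1 h2 h3 h4 => ?_, fun j U h1 h2 h3 h4 => ?_⟩
    -- To extend `U` into `S j`, `K j` is filled according to hole point `0` and its complement
    -- according to hole point `2`; for either type these two points lie on different strands.
    · let W : ∀ j, Set (S j).End := fun j =>
        {x | (x ∈ K j → (.inr (.inr (.inl (j, 0))) : T.End) ∈ U) ∧
          (x ∉ K j → (.inr (.inr (.inl (j, 2))) : T.End) ∈ U)}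
      have hW := h (joinParts T S U W) ?_ ?_ ?_ ?_
      · rw [eq_univ_iff_parts, basePart_joinParts] at hW
        exact hW.1
      · rw [localInvariant_comp_iff, basePart_joinParts]
        simp only [insertPart_joinParts]
        refine ⟨h1, fun j => ?_, fun j i => ?_⟩
        · have a := (hp j).local_K
          have b := a.compl
          exact ⟨fun x hx => ⟨fun hK => hx.1 (by
              by_contra hn; exact b.edge x hn hK),
              fun hK => hx.2 fun hn => hK (a.edge x hn)⟩,
            fun c i hx => ⟨fun hK => hx.1 (by
              by_contra hn; exact b.crossing c i hn hK),
              fun hK => hx.2 fun hn => hK (a.crossing c i hn)⟩,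
            fun x hx => ⟨fun hK => hx.1 (by
              by_contra hn; exact b.mark x hn hK),
              fun hK => hx.2 fun hn => hK (a.mark x hn)⟩⟩
        · have hh : ∀ i, (.inr (.inr (.inl (j, i))) : T.End) ∈ U ↔
              (.inr (.inr (.inl (j, fundamental (p j) i))) : T.End) ∈ U := fun i =>
            ⟨h2 j i, fun h => by simpa [fundamental_invol] using h2 j _ h⟩
          have hd : ∀ (p : Fin 2) (i : Fin 4), ((i = 0 ∨ i = fundamental p 0) ∧
              (i = 0 ∨ fundamental p i = 0)) ∨ (¬ (i = 0 ∨ i = fundamental p 0) ∧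
              (i = 2 ∨ fundamental p i = 2)) := by decide
          change _ ↔ (_ ∈ K j → _) ∧ (_ ∉ K j → _)
          rw [(hp j).outer_K]
          rcases hd (p j) i with ⟨a, rfl | b⟩ | ⟨a, rfl | b⟩
          · tauto
          · rw [hh i, b]; tauto
          · tauto
          · rw [hh i, b]; tauto
      · rw [holesInvariant_comp_iff]
        simp only [insertPart_joinParts]
        intro j
        have a := (hp j).holes_K
        have b := a.compl
        exact fun m i hx => ⟨fun hK => hx.1 (by
              by_contra hn; exact b m i hn hK),
              fun hK => hx.2 fun hn => hK (a m i hn)⟩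
      · rw [outerInvariant_comp_iff, basePart_joinParts]
        exact h3
      · rw [nonempty_iff_parts, basePart_joinParts]
        exact Or.inl h4
    · classical
      -- By `houter`, `U` contains all outer ends of `S j` or none. It is extended by everything
      -- outside `S j` in the first case, and by nothing in the second.
      by_cases ho : (S j).outer 0 ∈ U
      · have hU := h (joinParts T S Set.univ
          (Function.update (fun j => (Set.univ : Set (S j).End)) j U)) ?_ ?_ ?_ ?_
        · rw [eq_univ_iff_parts] at hU
          have := hU.2 j
          rwa [insertPart_joinParts, Function.update_self] at this
        · rw [localInvariant_comp_iff, basePart_joinParts]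
          simp only [insertPart_joinParts]
          refine ⟨⟨fun _ _ => trivial, fun _ _ _ => trivial, fun _ _ => trivial⟩,
            fun j' => ?_, fun j' i => ?_⟩
          · by_cases hj : j' = j
            · subst hj
              rwa [Function.update_self]
            · rw [Function.update_of_ne hj]
              exact ⟨fun _ _ => trivial, fun _ _ _ => trivial, fun _ _ => trivial⟩
          · by_cases hj : j' = j
            · subst hj
              rw [Function.update_self]
              exact ⟨fun _ => houter _ U h1 h2 h3 0 i ho, fun _ => trivial⟩
            · rw [Function.update_of_ne hj]
              exact ⟨fun _ => trivial, fun _ => trivial⟩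
        · rw [holesInvariant_comp_iff]
          simp only [insertPart_joinParts]
          intro j'
          by_cases hj : j' = j
          · subst hj
            rwa [Function.update_self]
          · rw [Function.update_of_ne hj]
            exact fun _ _ _ => trivial
        · rw [outerInvariant_comp_iff, basePart_joinParts]
          exact fun _ _ => trivial
        · rw [nonempty_iff_parts, basePart_joinParts]
          exact Or.inl ⟨T.outer 0, trivial⟩
      · have hnone : ∀ i, (S j).outer i ∉ U := fun i hi => ho (houter j U h1 h2 h3 i 0 hi)
        have hU := h (joinParts T S ∅
          (Function.update (fun j => (∅ : Set (S j).End)) j U)) ?_ ?_ ?_ ?_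
        · rw [eq_univ_iff_parts, basePart_joinParts] at hU
          have : T.outer 0 ∈ (∅ : Set T.End) := hU.1.symm ▸ Set.mem_univ _
          exact this.elim
        · rw [localInvariant_comp_iff, basePart_joinParts]
          simp only [insertPart_joinParts]
          refine ⟨⟨fun _ h => h.elim, fun _ _ h => h.elim, fun _ h => h.elim⟩,
            fun j' => ?_, fun j' i => ?_⟩
          · by_cases hj : j' = j
            · subst hj
              rwa [Function.update_self]
            · rw [Function.update_of_ne hj]
              exact ⟨fun _ h => h.elim, fun _ _ h => h.elim, fun _ h => h.elim⟩
          · by_cases hj : j' = j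
            · subst hj
              rw [Function.update_self]
              exact ⟨fun h => h.elim, fun h => (hnone i h).elim⟩
            · rw [Function.update_of_ne hj]
              exact ⟨fun h => h.elim, fun h => h.elim⟩
        · rw [holesInvariant_comp_iff]
          simp only [insertPart_joinParts]
          intro j'
          by_cases hj : j' = j
          · subst hj
            rwa [Function.update_self]
          · rw [Function.update_of_ne hj]
            exact fun _ _ h => h.elim
        · rw [outerInvariant_comp_iff, basePart_joinParts]
          exact fun _ h => h.elim
        · rw [nonempty_iff_parts]
          refine Or.inr ⟨j, ?_⟩
          rwa [insertPart_joinParts, Function.update_self]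
  · rintro ⟨hT, hS⟩ U h1 h2 h3 h4
    rw [localInvariant_comp_iff] at h1
    rw [holesInvariant_comp_iff] at h2
    rw [outerInvariant_comp_iff] at h3
    obtain ⟨h1, h1', hglue⟩ := h1
    -- Seen from `T`, the strands through `S j` act as the fundamental tangle `p j`.
    have hholes : T.HolesInvariant p (basePart T S U) := fun j i hx =>
      (hglue j _).2 ((hp j).outer_mem _ (h1' j) (h2 j) i ((hglue j i).1 hx))
    by_cases hne : (basePart T S U).Nonempty
    · have hu := hT _ h1 hholes h3 hne
      refine (eq_univ_iff_parts U).2 ⟨hu, fun j => ?_⟩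
      have ho : ∀ i, (S j).outer i ∈ insertPart T S U j :=
        fun i => (hglue j i).1 (hu.symm ▸ Set.mem_univ _)
      exact hS j _ (h1' j) (h2 j) (fun i _ => ho _) ⟨_, ho 0⟩
    · rcases (nonempty_iff_parts U).1 h4 with h | ⟨j, hj⟩
      · exact absurd h hne
      · have ho : ∀ i, (S j).outer i ∉ insertPart T S U j :=
          fun i hi => hne ⟨_, (hglue j i).2 hi⟩
        have := hS j _ (h1' j) (h2 j) (fun i hi => (ho i hi).elim) hj
        exact absurd (this.symm ▸ Set.mem_univ _) (ho 0)

end Composition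

end TangleDiagram

/-! ### The bracket of a composite and the matrix product -/

theorem indicator_eq_mul_of_iff {ι : Type*} [Fintype ι] {P Q : Prop} {R : ι → Prop} {_ : Decidable P}
    {_ : Decidable Q} {_ : Decidable (∀ j ∈ Finset.univ, R j)} (h : P ↔ Q ∧ ∀ j, R j) :
    (if P then 1 else 0 : ℂ) =
      (if Q then 1 else 0) * if ∀ j ∈ Finset.univ, R j then 1 else 0 := by
  by_cases h1 : Q <;> by_cases h2 : ∀ j, R j <;> simp [h, h1, h2]

namespace TangleDiagram

variable {n : ℕ} {T : TangleDiagram n} {k : Fin n → ℕ} {S : ∀ j, TangleDiagram (k j)}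

open Classical in
/-- The contribution of a state to the bracket of a closure. -/
noncomputable def stateTerm (T : TangleDiagram n) (r : Fin 2) (f : Fin n → Fin 2)
    (s : T.Crossing → Splitting) : ℂ :=
  (∏ c, (s c).weight rootEight) * (if (T.closeUp r f).circles s = 1 then 1 else 0)

theorem bracket_closeUp_eq_sum_stateTerm (T : TangleDiagram n) (r : Fin 2) (f : Fin n → Fin 2) :
    (T.closeUp r f).bracket = ∑ s, T.stateTerm r f s :=
  bracket_closeUp T r f

variable (T S) in
/-- A state of a composite consists of states of the pieces. -/
def compStateEquiv : ((T.comp S).Crossing → Splitting) ≃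
    (T.Crossing → Splitting) × (∀ j, (S j).Crossing → Splitting) where
  toFun s := (fun c => s (.inl c), fun j c => s (.inr ⟨j, c⟩))
  invFun s := Sum.elim s.1 fun x => s.2 x.1 x.2
  left_inv s := by ext (c | ⟨j, c⟩) <;> rfl
  right_inv s := rfl

theorem prod_weight_comp (s : (T.comp S).Crossing → Splitting) :
    ∏ c, (s c).weight rootEight = (∏ c, ((compStateEquiv T S s).1 c).weight rootEight) *
      ∏ j, ∏ c, ((compStateEquiv T S s).2 j c).weight rootEight :=
  (Fintype.prod_sum_type fun c : T.Crossing ⊕ (Σ j, (S j).Crossing) =>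
    (s c).weight rootEight).trans (congrArg _ (Fintype.prod_sigma _))

/-- The sum has one possibly nonzero term, at the tuple of actual strand types. Summing over all
tuples removes the dependence on the state, so that the sum over states can factor. -/
theorem stateTerm_comp (hS : ∀ j, (S j).IsPlanar) (r : Fin 2) (g : Fin (∑ j, k j) → Fin 2)
    (s : (T.comp S).Crossing → Splitting) :
    (T.comp S).stateTerm r g s = ∑ p : Fin n → Fin 2,
      T.stateTerm r p (compStateEquiv T S s).1 * ∏ j, (S j).stateTerm (p j)
        (fun m => g (finSigmaFinEquiv ⟨j, m⟩)) ((compStateEquiv T S s).2 j) := by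
  classical
  choose p K hp using fun j => (hS j).exists_hasType (fun m => g (finSigmaFinEquiv ⟨j, m⟩))
    ((compStateEquiv T S s).2 j)
  rw [Finset.sum_eq_single p]
  · have hiff := circles_comp_eq_one_iff (T := T) r g s hp
    simp only [stateTerm]
    rw [prod_weight_comp, Finset.prod_mul_distrib, Finset.prod_boole, mul_mul_mul_comm]
    congr 1
    exact indicator_eq_mul_of_iff hiff
  · intro q _ hq
    obtain ⟨j, hj⟩ := Function.ne_iff.1 hq
    refine mul_eq_zero_of_right _ (Finset.prod_eq_zero (Finset.mem_univ j) ?_)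
    rw [stateTerm, if_neg fun h => hj ((hp j).eq_of_circles_eq_one h), mul_zero]
  · exact fun h => (h (Finset.mem_univ _)).elim

/-- The bracket of a composite, by expansion of the inserted diagrams in the fundamental tangles. -/
theorem bracket_comp (hS : ∀ j, (S j).IsPlanar) (r : Fin 2) (g : Fin (∑ j, k j) → Fin 2) :
    ((T.comp S).closeUp r g).bracket = ∑ p : Fin n → Fin 2, (T.closeUp r p).bracket *
      ∏ j, ((S j).closeUp (p j) fun m => g (finSigmaFinEquiv ⟨j, m⟩)).bracket := by
  classical
  simp only [bracket_closeUp_eq_sum_stateTerm, stateTerm_comp hS]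
  rw [Finset.sum_comm]
  refine Finset.sum_congr rfl fun p _ => ?_
  rw [Finset.prod_univ_sum, Fintype.piFinset_univ, Finset.sum_mul_sum, ← Finset.sum_product',
    Finset.univ_product_univ]
  exact Fintype.sum_equiv (compStateEquiv T S) _ _ fun s => rfl

/-- The exponents `t` add up over the blocks of a concatenated word, so only the factors attached to
the intermediate filling remain to be compared. -/
theorem bracketMatrix_comp (hS : ∀ j, (S j).IsPlanar) (r : Fin 2) (c : Fin (2 ^ ∑ j, k j)) :
    bracketMatrix (T.comp S) r c = ∑ f : Fin (2 ^ n), bracketMatrix T r f *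
      ∏ j, bracketMatrix (S j) (alpha n f j) (alphaPow k c j) := by
  simp only [bracketMatrix, Matrix.of_apply]
  rw [bracket_comp hS, ← (alpha_bijective n).sum_comp, Finset.mul_sum]
  refine Finset.sum_congr rfl fun f _ => ?_
  simp only [Finset.prod_mul_distrib, Finset.prod_pow_eq_pow_sum, alpha_finSigmaFinEquiv]
  have h1 : tExponent (∑ j, k j) c = ∑ j, tExponent (k j) (alphaPow k c j) := by
    simp only [tExponent_eq_sum_alpha]
    rw [← finSigmaFinEquiv.sum_comp, Fintype.sum_sigma]
    simp only [alpha_finSigmaFinEquiv]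
  -- The column factors of `T` cancel the row factors of the inserted diagrams, since `(-i) * i =
  -- 1`; this is the purpose of the normalization.
  have h2 : (-Complex.I) ^ tExponent n f * Complex.I ^ ∑ j, (alpha n f j : ℕ) = 1 := by
    rw [tExponent_eq_sum_alpha, ← mul_pow, neg_mul, Complex.I_mul_I, neg_neg, one_pow]
  rw [h1]
  linear_combination (-(-Complex.I) ^ (∑ j, tExponent (k j) (alphaPow k c j)) *
    Complex.I ^ (r : ℕ) * (T.closeUp r (alpha n f)).bracket *
    ∏ j, ((S j).closeUp (alpha n f j) (alpha (k j) (alphaPow k c j))).bracket) * h2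

theorem mul_eta_mem_tangleInvariant_comp (hS : ∀ j, (S j).IsPlanar)
    {M : Matrix (Fin 2) (Fin (2 ^ n)) ℤ} (hM : M ∈ tangleInvariant T)
    {b : ∀ j, Matrix (Fin 2) (Fin (2 ^ k j)) ℤ} (hb : ∀ j, b j ∈ tangleInvariant (S j)) :
    M * eta k b ∈ tangleInvariant (T.comp S) := by
  obtain ⟨z, hz, hzM⟩ := hM
  choose w hw hwb using hb
  -- Each term of the expansion is linear in the matrix of `T` and in that of every inserted
  -- diagram, so the scalars multiply.
  refine ⟨z * ∏ j, w j, ?_, ?_⟩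
  · rw [mul_pow, hz, ← Finset.prod_pow]
    simp [hw]
  · ext r c
    have e1 : ∀ f, (M r f : ℂ) = z * bracketMatrix T r f := fun f =>
      congrFun (congrFun hzM r) f
    have e2 : ∀ j a d, (b j a d : ℂ) = w j * bracketMatrix (S j) a d := fun j a d =>
      congrFun (congrFun (hwb j) a) d
    simp only [Matrix.map_apply, Matrix.mul_apply, eta, Matrix.of_apply, Matrix.smul_apply,
      smul_eq_mul, Int.cast_sum, Int.cast_mul, Int.cast_prod, e1, e2]
    rw [bracketMatrix_comp hS, Finset.mul_sum]
    refine Finset.sum_congr rfl fun f _ => ?_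
    rw [Finset.prod_mul_distrib]
    ring

end TangleDiagram

theorem classMul_signClass {l m n : ℕ} (M : Matrix (Fin l) (Fin m) ℤ)
    (N : Matrix (Fin m) (Fin n) ℤ) :
    classMul (signClass M) (signClass N) = signClass (M * N) := by
  simp only [classMul, signClass, Set.image2_insert_left, Set.image2_singleton_left,
    Set.image_pair, Matrix.mul_neg, Matrix.neg_mul, neg_neg]
  rw [Set.pair_comm (-(M * N)), Set.union_self]

theorem theorem3p8 (n : ℕ) (hn : 1 ≤ n) (k : Fin n → ℕ)
    (T : TangleDiagram n) (S : ∀ j : Fin n, TangleDiagram (k j))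
    (hT : T.IsPlanar) (hS : ∀ j, (S j).IsPlanar) :
    tangleInvariant T ∈ PM 2 (2 ^ n) ∧
    (∀ j, tangleInvariant (S j) ∈ PM 2 (2 ^ k j)) ∧
    tangleInvariant (T.comp S) ∈ PM 2 (2 ^ ∑ j, k j) ∧
    ∀ b : ∀ j, Matrix (Fin 2) (Fin (2 ^ k j)) ℤ,
      (∀ j, tangleInvariant (S j) = signClass (b j)) →
        tangleInvariant (T.comp S) = classMul (tangleInvariant T) (signClass (eta k b)) := by
  obtain ⟨M, hM⟩ := hT.exists_integral
  choose b₀ hb₀ using fun j => (hS j).exists_integral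
  refine ⟨hT.tangleInvariant_mem_PM, fun j => (hS j).tangleInvariant_mem_PM,
    ⟨M * eta k b₀, (tangleInvariant_eq_signClass
      (TangleDiagram.mul_eta_mem_tangleInvariant_comp hS hM hb₀)).symm⟩, fun b hb => ?_⟩
  have hb' : ∀ j, b j ∈ tangleInvariant (S j) := fun j => by
    rw [hb j]
    exact Set.mem_insert _ _
  rw [tangleInvariant_eq_signClass hM, classMul_signClass]
  exact tangleInvariant_eq_signClass (TangleDiagram.mul_eta_mem_tangleInvariant_comp hS hM hb')
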